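/- **Conventions.** An ensemble $\mathcal D(\mu,1)^{n\times n}$ is the law of an $n\times n$ complex random matrix with independent (not necessarily identically distributed) entries of mean $\mu$ and variance $1$. Each ensemble is written $A=\mu J+A'$ with $A'\sim\mathcal D(0,1)^{n\times n}$ centered and $J$ the all-ones matrix. A deterministic quasi-polynomial-time algorithm is a finite program for a random access machine over $\mathbb C$ (exact field operations and zero tests on complex numbers at unit cost, integer operations charged by bit length, no constants other than natural numbers) which, on every input consisting of $n$, a number (the mean of the entries) and a matrix $A\in\mathbb C^{n\times n}$, halts at cost at most $2^{(\log n)^{O(1)}}$. **Theorem.** Let $\delta=\delta(n)=1/\mathrm{poly}(n)$, i.e. $\delta(n)\ge n^{-c}$ for some constant $c$ and all large $n$. There are a deterministic quasi-polynomial-time algorithm and a constant $C>0$ such that for every sequence $\varepsilon=\varepsilon(n)$ with $$\varepsilon(n)\ \ge\ \left[\frac{\ln\ln\ln n}{\ln\ln n}\right]^{1/7}\quad\text{for all large } n$$ the following hold. 1. For every choice of centered ensembles $\mathcal D(0,1)^{n\times n}$, $n\ge 0$, there are means $\mu=\mu(n)\in[\varepsilon,\varepsilon+2\varepsilon^2]$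 such that, for a $1-o(1)$ fraction of the matrices $A\sim\mathcal D(\mu,1)^{n\times n}$, where $A=\mu J+A'$ with $A'\sim\mathcal D(0,1)^{n\times n}$, the algorithm with input $(n,\mu,A)$ outputs $$\mathcal O=\mathrm{Per}(A)\,(1+\mathcal E),\qquad \mathcal E\in\mathbb C,\quad |\mathcal E|\le C\delta .$$ 2. In particular the algorithm solves $\mathrm{GPE}_\times^{\varepsilon}$ to inverse polynomial precision: for a $1-o(1)$ fraction of the matrices $A\sim\mathcal N(\varepsilon,1,\mathbb C)^{n\times n}$ (independent complex Gaussian entries of mean $\varepsilon$ and variance $1$), its output on $(n,\varepsilon,A)$ is $\mathrm{Per}(A)(1+\mathcal E)$ with $|\mathcal E|\le C\delta$. Consequently (writing $\mu=1/\mathrm{polyloglog}(n)$ if $(\ln\ln n)^{-a}\le\mu(n)\le(\ln\ln n)^{-b}$ for some constants $a,b>0$ and all large $n$), for the same algorithm and constant: 3. (Biased Gaussian) There is $\mu=1/\mathrm{polyloglog}(n)$ such that the algorithm approximates $\mathrm{Per}(A)$ within relative error $C\delta$ on a $1-o(1)$ fraction of $A\sim\mathcal N(\mu,1,\mathbb C)^{n\times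 n}$. 4. (Slightly biased Bernoulli) There is $\mu=1/\mathrm{polyloglog}(n)$ such that the algorithm, given the mean $\mu/2$ of the entries, approximates $\mathrm{Per}(A)$ within relative error $C\delta$ on a $1-o(1)$ fraction of the matrices $A$ with independent entries equal to $1$ with probability $1/2$ and to $-1+\mu$ with probability $1/2$. -/

import Mathlib

open Filter Topology MeasureTheory ProbabilityTheory

/-! ### A deterministic random access machine over the complex numbers

The memory has two infinite arrays: natural numbers `reg` (used for control and addresses) and
complex numbers `num` (on which exact field operations are performed). Field operations on complex
numbers have unit cost, operations on natural numbers are charged by bit length. The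
programs are finite and contain no constants other than natural numbers. -/

/-- The memory of the machine. -/
structure MemState where
  reg : ℕ → ℕ
  num : ℕ → ℂ

/-- Natural number expressions. `reg a` is the content of the register whose address is the
value of `a`. -/
inductive NatExpr : Type
  | lit (c : ℕ)
  | reg (a : NatExpr)
  | add (a b : NatExpr)
  | sub (a b : NatExpr)
  | mul (a b : NatExpr)
  | div (a b : NatExpr)
  | mod (a b : NatExpr)

/-- Value of a natural number expression (truncated subtraction, integer division). -/
def NatExpr.eval (s : MemState) : NatExpr → ℕ
  | .lit c => c
  | .reg a => s.reg (a.eval s)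
  | .add a b => a.eval s + b.eval s
  | .sub a b => a.eval s - b.eval s
  | .mul a b => a.eval s * b.eval s
  | .div a b => a.eval s / b.eval s
  | .mod a b => a.eval s % b.eval s

/-- Logarithmic cost: each node of the expression costs one plus the bit length of its value. -/
def NatExpr.cost (s : MemState) : NatExpr → ℕ
  | .lit c => 1 + Nat.size c
  | .reg a => a.cost s + (1 + Nat.size (s.reg (a.eval s)))
  | .add a b => a.cost s + b.cost s + (1 + Nat.size (a.eval s + b.eval s))
  | .sub a b => a.cost s + b.cost s + (1 + Nat.size (a.eval s - b.eval s))
  | .mul a b => a.cost s + b.cost s + (1 + Nat.size (a.eval s * b.eval s))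
  | .div a b => a.cost s + b.cost s + (1 + Nat.size (a.eval s / b.eval s))
  | .mod a b => a.cost s + b.cost s + (1 + Nat.size (a.eval s % b.eval s))

/-- Complex number expressions. `num a` is the content of the complex cell whose address is the
value of `a`, and `cast a` is the value of `a` as a complex number. -/
inductive NumExpr : Type
  | num (a : NatExpr)
  | cast (a : NatExpr)
  | add (x y : NumExpr)
  | sub (x y : NumExpr)
  | mul (x y : NumExpr)
  | div (x y : NumExpr)

/-- Value of a complex number expression (exact arithmetic; division by zero returns zero). -/
noncomputable def NumExpr.eval (s : MemState) : NumExpr → ℂ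
  | .num a => s.num (a.eval s)
  | .cast a => (a.eval s : ℂ)
  | .add x y => x.eval s + y.eval s
  | .sub x y => x.eval s - y.eval s
  | .mul x y => x.eval s * y.eval s
  | .div x y => x.eval s / y.eval s

/-- Each access or field operation costs one, and addresses are charged as natural numbers. -/
def NumExpr.cost (s : MemState) : NumExpr → ℕ
  | .num a => a.cost s + 1
  | .cast a => a.cost s + 1
  | .add x y => x.cost s + y.cost s + 1
  | .sub x y => x.cost s + y.cost s + 1
  | .mul x y => x.cost s + y.cost s + 1
  | .div x y => x.cost s + y.cost s + 1

/-- Branching conditions: comparison of natural numbers, and zero test for complex numbers. -/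
inductive BranchTest : Type
  | lt (a b : NatExpr)
  | isZero (x : NumExpr)

def BranchTest.Holds (s : MemState) : BranchTest → Prop
  | .lt a b => a.eval s < b.eval s
  | .isZero x => x.eval s = 0

def BranchTest.cost (s : MemState) : BranchTest → ℕ
  | .lt a b => a.cost s + b.cost s + 1
  | .isZero x => x.cost s + 1

/-- Programs: assignments `reg[d] := e` and `num[d] := x`, composition, branching, loops. -/
inductive Program : Type
  | skip
  | setReg (d e : NatExpr)
  | setNum (d : NatExpr) (x : NumExpr)
  | seq (p q : Program)
  | branch (b : BranchTest) (p q : Program)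
  | loop (b : BranchTest) (p : Program)

/-- `Exec p s s' t`: started in memory `s`, the program `p` halts in memory `s'` at total
cost `t`. `loop b p` repeats `p` while `b` holds. -/
inductive Exec : Program → MemState → MemState → ℕ → Prop
  | skip (s : MemState) : Exec .skip s s 1
  | setReg (d e : NatExpr) (s : MemState) :
      Exec (.setReg d e) s
        { s with reg := Function.update s.reg (d.eval s) (e.eval s) }
        (d.cost s + e.cost s + 1)
  | setNum (d : NatExpr) (x : NumExpr) (s : MemState) :
      Exec (.setNum d x) s
        { s with num := Function.update s.num (d.eval s) (x.eval s) }
        (d.cost s + x.cost s + 1)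
  | seq {p q : Program} {s s' s'' : MemState} {t u : ℕ} :
      Exec p s s' t → Exec q s' s'' u → Exec (.seq p q) s s'' (t + u + 1)
  | branch_true {b : BranchTest} {p q : Program} {s s' : MemState} {t : ℕ} :
      b.Holds s → Exec p s s' t → Exec (.branch b p q) s s' (b.cost s + t + 1)
  | branch_false {b : BranchTest} {p q : Program} {s s' : MemState} {t : ℕ} :
      ¬ b.Holds s → Exec q s s' t → Exec (.branch b p q) s s' (b.cost s + t + 1)
  | loop_true {b : BranchTest} {p : Program} {s s' s'' : MemState} {t u : ℕ} :
      b.Holds s → Exec p s s' t → Exec (.loop b p) s' s'' u →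
        Exec (.loop b p) s s'' (b.cost s + t + u + 1)
  | loop_false {b : BranchTest} {p : Program} {s : MemState} :
      ¬ b.Holds s → Exec (.loop b p) s s (b.cost s + 1)

/-- The input: `reg[0] = n`, `num[0] = m` (the mean of the ensemble), and the entries of the
`n × n` matrix `A` row by row in `num[1], …, num[n²]`; all other cells are zero. -/
noncomputable def inputState (n : ℕ) (m : ℂ) (A : Fin n → Fin n → ℂ) : MemState where
  reg := fun a => if a = 0 then n else 0
  num := fun a =>
    if a = 0 then m
    else if h : a - 1 < n * n then
      A (finProdFinEquiv.symm ⟨a - 1, h⟩).1 (finProdFinEquiv.symm ⟨a - 1, h⟩).2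
    else 0

/-- On every input of dimension `n` the program halts at cost at most `2 ^ polylog(n)`. -/
def QuasiPolyTime (P : Program) : Prop :=
  ∃ k : ℕ, ∀ (n : ℕ) (m : ℂ) (A : Fin n → Fin n → ℂ),
    ∃ (s : MemState) (t : ℕ), Exec P (inputState n m A) s t ∧
      t ≤ 2 ^ ((Nat.log 2 n + k) ^ k)

/-- On the input `(n, m, A)` the program outputs, in `num[0]`, the number `Per(A) (1 + E)`
for some complex `E` of modulus at most `η`. -/
def ApproxPermanent (P : Program) (η : ℝ) (n : ℕ) (m : ℂ) (A : Fin n → Fin n → ℂ) : Prop :=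
  ∃ (s : MemState) (t : ℕ) (E : ℂ), Exec P (inputState n m A) s t ∧
    s.num 0 = (Matrix.of A).permanent * (1 + E) ∧ ‖E‖ ≤ η

/-! ### Random matrices -/

/-- `ν` is a probability distribution on `ℂ` with mean `m` and (finite) variance `v`. -/
structure HasMeanVariance (ν : Measure ℂ) (m : ℂ) (v : ℝ) : Prop where
  isProbabilityMeasure : IsProbabilityMeasure ν
  memLp : MemLp (fun x : ℂ => x) 2 ν
  mean : ∫ x, x ∂ν = m
  variance : ∫ x, ‖x - m‖ ^ 2 ∂ν = v

/-- The law of an `n × n` matrix with independent entries, the `(i, j)` entry having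
law `ν i j`. -/
noncomputable def matrixLaw {n : ℕ} (ν : Fin n → Fin n → Measure ℂ) :
    Measure (Fin n → Fin n → ℂ) :=
  Measure.pi fun i => Measure.pi fun j => ν i j

/-- The law of `X + m` when `X` has law `ν`. -/
noncomputable def shiftLaw (ν : Measure ℂ) (m : ℝ) : Measure ℂ :=
  ν.map fun x => x + (m : ℂ)

/-- The complex Gaussian law of mean `m` and variance `1`: independent real and imaginary parts
of variance `1 / 2` each. -/
noncomputable def complexGaussian (m : ℝ) : Measure ℂ :=
  ((gaussianReal m (1 / 2)).prod (gaussianReal 0 (1 / 2))).map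
    fun p : ℝ × ℝ => (⟨p.1, p.2⟩ : ℂ)

/-- The biased Bernoulli law: `1` with probability `1 / 2` and `-1 + m` with probability
`1 / 2`. Its mean is `m / 2`. -/
noncomputable def biasedBernoulli (m : ℝ) : Measure ℂ :=
  (1 / 2 : ENNReal) • Measure.dirac (1 : ℂ) +
    (1 / 2 : ENNReal) • Measure.dirac (-1 + (m : ℂ))

/-- For random matrices `A` with law `law n`, the program, given `n`, the number `m n` and `A`,
approximates `Per(A)` within relative error `η n`, except with probability `o(1)`. -/
def ApproxPermanentTypically (P : Program) (η : ℕ → ℝ) (m : ℕ → ℝ)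
    (law : (n : ℕ) → Measure (Fin n → Fin n → ℂ)) : Prop :=
  Tendsto (fun n : ℕ => law n {A | ¬ ApproxPermanent P (η n) n (m n : ℂ) A}) atTop (𝓝 0)

/-- `δ = 1 / poly(n)`, as a precision: `δ` is at least some inverse power of `n`. -/
def InvPoly (δ : ℕ → ℝ) : Prop :=
  ∃ c : ℕ, ∀ᶠ n : ℕ in atTop, 1 / (n : ℝ) ^ c ≤ δ n

/-- `μ = 1 / polyloglog(n)`: `μ` lies between two negative powers of `ln ln n`. -/
def InvPolyLogLog (μ : ℕ → ℝ) : Prop :=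
  ∃ a b : ℝ, 0 < a ∧ 0 < b ∧ ∀ᶠ n : ℕ in atTop,
    Real.log (Real.log n) ^ (-a) ≤ μ n ∧ μ n ≤ Real.log (Real.log n) ^ (-b)

/-- The lower bound `ε ≥ (ln ln ln n / ln ln n)^(1/7)`, for large `n`. -/
def MeanLowerBound (ε : ℕ → ℝ) : Prop :=
  ∀ᶠ n : ℕ in atTop,
    (Real.log (Real.log (Real.log n)) / Real.log (Real.log n)) ^ (1 / 7 : ℝ) ≤ ε n

/-! ### Cost bounds and total correctness rules for the machine -/

/-! Write `A = m J + B` with `B` centered, and put `z = 1/m`. Choosing, in each factor of the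
permanent, either the constant or the entry of `B` gives `Per(A) = m ^ n n! g(z)`. Here `g(z) =
Per(J + z B)/n!` is a polynomial with `g(0) = 1`, and its coefficient of degree `k` is `minorSum B k
/ n!`. The program evaluates the truncation of `g` at degree `t`, the bit length of `n`. It
enumerates sequences of at most `t` cells, encoded as numbers below `(n² + 1) ^ t`, so the running
time is quasi-polynomial (`permanentProgram_output`, `permanentProgram_quasiPolyTime`).

The truncation error is small in mean square. Distinct monomials in independent centered entries of
variance one are orthonormal, so the remainder has second moment `∑_{t<k≤n} |z|^(2k)/k!`
(`taylorRemainder_second_moment`). For `|z| ≤ ln ln n` and `t ≈ log₂ n` the factorial beats every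
other factor, including the inverse square of the threshold below and any fixed power of `n`
(`tendsto_tailBound`).

A relative error also needs the truncated polynomial not to be tiny. Since it has degree at most `t`
and equals one at the origin, Lagrange interpolation shows that for any fixed `B` at most `t` of `N`
well separated points can give a value below `sizeThreshold` (`card_small_values_le`). With `N = t
⌈ln ln n⌉`, averaging over `B` yields one point, depending only on the law, at which smallness has
probability at most `1/⌈ln ln n⌉` (`exists_candidate`).

For general entries the candidate points lie on a short real interval, and the chosen one prescribes
the mean (`exists_mean`). The Bernoulli law is treated in the same way, as an affine image of a
random sign. For Gaussian entries the candidates lie on a circle; rotation invariance makes all its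
points equally good, so the prescribed mean itself works (`gaussian_not_isGood_le`). -/

def NatExpr.weight : NatExpr → ℕ
  | .lit c => c + 1
  | .reg a => a.weight + 1
  | .add a b => a.weight + b.weight + 1
  | .sub a b => a.weight + b.weight + 1
  | .mul a b => a.weight + b.weight + 1
  | .div a b => a.weight + b.weight + 1
  | .mod a b => a.weight + b.weight + 1

def NumExpr.weight : NumExpr → ℕ
  | .num a => a.weight + 1
  | .cast a => a.weight + 1
  | .add a b => a.weight + b.weight + 1
  | .sub a b => a.weight + b.weight + 1
  | .mul a b => a.weight + b.weight + 1
  | .div a b => a.weight + b.weight + 1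

def BranchTest.weight : BranchTest → ℕ
  | .lt a b => a.weight + b.weight + 1
  | .isZero x => x.weight + 1

/-- All registers of the memory are at most `V`. -/
def MemState.BoundedBy (s : MemState) (V : ℕ) : Prop := ∀ a, s.reg a ≤ V

/-- A literal `c` has weight `c + 1` because `c ≤ 2 ^ c ≤ V ^ c`. For sums, the extra unit of weight
provides a factor `V ≥ 2`, and `x + y ≤ 2 x y` for positive `x`, `y`. -/
theorem NatExpr.eval_le {s : MemState} {V : ℕ} (hV : 2 ≤ V) (hs : s.BoundedBy V) (e : NatExpr) :
    e.eval s ≤ V ^ e.weight := by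
  have h1 : 1 ≤ V := by omega
  induction e with
  | lit c =>
    exact (Nat.lt_two_pow_self).le.trans
      ((Nat.pow_le_pow_left hV c).trans (Nat.pow_le_pow_right h1 (Nat.le_succ c)))
  | reg a _ => exact (hs _).trans (Nat.le_self_pow (by simp [weight]) V)
  | add a b iha ihb =>
    have hp : 1 ≤ V ^ a.weight := Nat.one_le_pow _ _ h1
    have hq : 1 ≤ V ^ b.weight := Nat.one_le_pow _ _ h1
    simp only [eval, weight, pow_add, pow_one]
    nlinarith [Nat.mul_le_mul hp hq, Nat.mul_le_mul_left (V ^ a.weight * V ^ b.weight) hV]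
  | mul a b iha ihb =>
    calc _ ≤ V ^ a.weight * V ^ b.weight := Nat.mul_le_mul iha ihb
      _ = V ^ (a.weight + b.weight) := (pow_add _ _ _).symm
      _ ≤ _ := Nat.pow_le_pow_right h1 (Nat.le_succ _)
  | sub a b iha _ =>
    exact (Nat.sub_le _ _).trans (iha.trans (Nat.pow_le_pow_right h1 (by simp only [weight]; omega)))
  | div a b iha _ =>
    exact (Nat.div_le_self _ _).trans
      (iha.trans (Nat.pow_le_pow_right h1 (by simp only [weight]; omega)))
  | mod a b iha _ =>
    exact (Nat.mod_le _ _).trans (iha.trans (Nat.pow_le_pow_right h1 (by simp only [weight]; omega)))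

theorem Nat.size_pow_le (V k : ℕ) : Nat.size (V ^ k) ≤ k * Nat.size V + 1 := by
  rw [Nat.size_le, pow_succ, Nat.mul_comm k, pow_mul]
  have h : V ^ k ≤ (2 ^ V.size) ^ k := Nat.pow_le_pow_left (Nat.lt_size_self V).le k
  have : 0 < (2 ^ V.size) ^ k := by positivity
  omega

/-- There are at most `weight` nodes, and by `NatExpr.eval_le` the value at each has bit length at
most `weight * size V + 1`. -/
theorem NatExpr.cost_le {s : MemState} {V : ℕ} (hV : 2 ≤ V) (hs : s.BoundedBy V) (e : NatExpr) :
    e.cost s ≤ e.weight * (2 + e.weight * Nat.size V) := by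
  have key : ∀ e : NatExpr, Nat.size (e.eval s) ≤ e.weight * Nat.size V + 1 := fun e =>
    (Nat.size_le_size (e.eval_le hV hs)).trans (Nat.size_pow_le _ _)
  have bin : ∀ a b x y S p : ℕ, x ≤ a * (2 + a * S) → y ≤ b * (2 + b * S) →
      p ≤ (a + b + 1) * S + 1 → x + y + (1 + p) ≤ (a + b + 1) * (2 + (a + b + 1) * S) := by
    intro a b x y S p hx hy hp
    nlinarith [Nat.zero_le (a * b * S), Nat.zero_le (a * S), Nat.zero_le (b * S)]
  induction e with
  | lit c =>
    have := key (.lit c)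
    simp only [eval, weight, cost] at this ⊢
    nlinarith [Nat.zero_le (c * V.size), Nat.zero_le (c * (c + 1) * V.size)]
  | reg a iha =>
    have := key (.reg a)
    simp only [eval, weight, cost] at this ⊢
    nlinarith [Nat.zero_le (a.weight * V.size)]
  | add a b iha ihb => exact bin _ _ _ _ _ _ iha ihb (key (.add a b))
  | mul a b iha ihb => exact bin _ _ _ _ _ _ iha ihb (key (.mul a b))
  | sub a b iha ihb => exact bin _ _ _ _ _ _ iha ihb (key (.sub a b))
  | div a b iha ihb => exact bin _ _ _ _ _ _ iha ihb (key (.div a b))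
  | mod a b iha ihb => exact bin _ _ _ _ _ _ iha ihb (key (.mod a b))

theorem NumExpr.cost_le {s : MemState} {V : ℕ} (hV : 2 ≤ V) (hs : s.BoundedBy V) (e : NumExpr) :
    e.cost s ≤ e.weight * (2 + e.weight * Nat.size V) := by
  have bin : ∀ a b x y S : ℕ, x ≤ a * (2 + a * S) → y ≤ b * (2 + b * S) →
      x + y + 1 ≤ (a + b + 1) * (2 + (a + b + 1) * S) := by
    intro a b x y S hx hy
    nlinarith [Nat.zero_le (a * b * S), Nat.zero_le (a * S), Nat.zero_le (b * S)]
  have un : ∀ a x S : ℕ, x ≤ a * (2 + a * S) → x + 1 ≤ (a + 1) * (2 + (a + 1) * S) := by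
    intro a x S hx
    nlinarith [Nat.zero_le (a * S)]
  induction e with
  | num a => exact un _ _ _ (a.cost_le hV hs)
  | cast a => exact un _ _ _ (a.cost_le hV hs)
  | add a b iha ihb => exact bin _ _ _ _ _ iha ihb
  | mul a b iha ihb => exact bin _ _ _ _ _ iha ihb
  | sub a b iha ihb => exact bin _ _ _ _ _ iha ihb
  | div a b iha ihb => exact bin _ _ _ _ _ iha ihb

/-- An upper bound for the cost of elementary operations of syntactic weight `w`. -/
def opCost (w V : ℕ) : ℕ := w * (2 + w * Nat.size V)

/-- Superadditivity in the weight: the cost of straight-line code can be bounded through its total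
syntactic weight alone. -/
theorem opCost_add_le (a b V : ℕ) : opCost a V + opCost b V + 1 ≤ opCost (a + b + 1) V := by
  unfold opCost
  nlinarith [Nat.zero_le (a * b * V.size), Nat.zero_le (a * V.size), Nat.zero_le (b * V.size)]

theorem opCost_mono {a b : ℕ} (h : a ≤ b) (V : ℕ) : opCost a V ≤ opCost b V := by
  unfold opCost; gcongr

theorem BranchTest.cost_le {s : MemState} {V : ℕ} (hV : 2 ≤ V) (hs : s.BoundedBy V)
    (b : BranchTest) : b.cost s ≤ opCost b.weight V := by
  cases b with
  | lt a b =>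
    exact (Nat.add_le_add_right (Nat.add_le_add (a.cost_le hV hs) (b.cost_le hV hs)) 1).trans
      (opCost_add_le _ _ _)
  | isZero x =>
    have h := x.cost_le hV hs
    simp only [cost, weight, opCost]
    nlinarith [Nat.zero_le (x.weight * V.size)]

/-- Started in `s`, the program halts at cost at most `T` in a memory satisfying `Q`. -/
def Halts (p : Program) (s : MemState) (T : ℕ) (Q : MemState → Prop) : Prop :=
  ∃ s' t, Exec p s s' t ∧ t ≤ T ∧ Q s'

theorem Halts.mono {p : Program} {s : MemState} {T T' : ℕ} {Q Q' : MemState → Prop}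
    (h : Halts p s T Q) (hT : T ≤ T') (hQ : ∀ s, Q s → Q' s) : Halts p s T' Q' := by
  obtain ⟨s', t, h1, h2, h3⟩ := h
  exact ⟨s', t, h1, h2.trans hT, hQ _ h3⟩

theorem Halts.seq {p q : Program} {s : MemState} {T U : ℕ} {Q : MemState → Prop}
    (h : Halts p s T fun s' => Halts q s' U Q) : Halts (.seq p q) s (T + U + 1) Q := by
  obtain ⟨s', t, h1, h2, s'', u, h3, h4, h5⟩ := h
  exact ⟨s'', _, .seq h1 h3, by omega, h5⟩

theorem Halts.setReg {d e : NatExpr} {s : MemState} {V : ℕ} {Q : MemState → Prop}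
    (hV : 2 ≤ V) (hs : s.BoundedBy V)
    (h : Q { s with reg := Function.update s.reg (d.eval s) (e.eval s) }) :
    Halts (.setReg d e) s (opCost (d.weight + e.weight + 1) V) Q :=
  ⟨_, _, .setReg d e s, (Nat.add_le_add_right (Nat.add_le_add (d.cost_le hV hs)
    (e.cost_le hV hs)) 1).trans (opCost_add_le _ _ _), h⟩

theorem Halts.setNum {d : NatExpr} {e : NumExpr} {s : MemState} {V : ℕ} {Q : MemState → Prop}
    (hV : 2 ≤ V) (hs : s.BoundedBy V)
    (h : Q { s with num := Function.update s.num (d.eval s) (e.eval s) }) :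
    Halts (.setNum d e) s (opCost (d.weight + e.weight + 1) V) Q :=
  ⟨_, _, .setNum d e s, (Nat.add_le_add_right (Nat.add_le_add (d.cost_le hV hs)
    (e.cost_le hV hs)) 1).trans (opCost_add_le _ _ _), h⟩

theorem MemState.BoundedBy.update {r : ℕ → ℕ} {x : ℕ → ℂ} {V : ℕ}
    (hs : MemState.BoundedBy ⟨r, x⟩ V) {d e : ℕ} (he : e ≤ V) :
    MemState.BoundedBy ⟨Function.update r d e, x⟩ V := by
  intro a
  by_cases h : a = d
  · subst h; simpa using he
  · simpa [h] using hs a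

/-- The weight of a program without branches and loops. -/
def Program.weight : Program → ℕ
  | .setReg d e => d.weight + e.weight + 1
  | .setNum d x => d.weight + x.weight + 1
  | .seq p q => p.weight + q.weight + 1
  | _ => 0

/-- A symbolic execution rule: address and value enter through equations, so that later steps see
simplified `D` and `E`. The bound on the registers is handed on to the rest of the program. -/
theorem Halts.seqSetReg {d e : NatExpr} {q : Program} {r : ℕ → ℕ} {x : ℕ → ℂ} {V D E : ℕ}
    {Q : MemState → Prop} (hV : 2 ≤ V) (hs : MemState.BoundedBy ⟨r, x⟩ V)
    (hd : d.eval ⟨r, x⟩ = D) (he : e.eval ⟨r, x⟩ = E) (hE : E ≤ V)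
    (h : MemState.BoundedBy ⟨Function.update r D E, x⟩ V →
      Halts q ⟨Function.update r D E, x⟩ (opCost q.weight V) Q) :
    Halts (.seq (.setReg d e) q) ⟨r, x⟩ (opCost (Program.seq (.setReg d e) q).weight V) Q := by
  subst hd he
  exact (Halts.seq (Halts.setReg hV hs (h (hs.update hE)))).mono (opCost_add_le _ _ V) fun _ h => h

theorem Halts.seqSetNum {d : NatExpr} {e : NumExpr} {q : Program} {r : ℕ → ℕ} {x : ℕ → ℂ}
    {V D : ℕ} {E : ℂ} {Q : MemState → Prop} (hV : 2 ≤ V) (hs : MemState.BoundedBy ⟨r, x⟩ V)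
    (hd : d.eval ⟨r, x⟩ = D) (he : e.eval ⟨r, x⟩ = E)
    (h : MemState.BoundedBy ⟨r, Function.update x D E⟩ V →
      Halts q ⟨r, Function.update x D E⟩ (opCost q.weight V) Q) :
    Halts (.seq (.setNum d e) q) ⟨r, x⟩ (opCost (Program.seq (.setNum d e) q).weight V) Q := by
  subst hd he
  exact (Halts.seq (Halts.setNum hV hs (h hs))).mono (opCost_add_le _ _ V) fun _ h => h

/-- Loop rule: `I a` is the invariant after `a` rounds, and there are at most `N` rounds. -/
theorem Halts.loop {b : BranchTest} {p : Program} {V T N : ℕ} {I : ℕ → MemState → Prop}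
    (hV : 2 ≤ V) (hb : ∀ a s, I a s → s.BoundedBy V)
    (hend : ∀ s, I N s → ¬ b.Holds s)
    (hbody : ∀ a s, a < N → I a s → b.Holds s → Halts p s T (I (a + 1)))
    {a : ℕ} {s : MemState} (ha : a ≤ N) (hI : I a s) :
    Halts (.loop b p) s ((N - a + 1) * (opCost b.weight V + T + 1))
      fun s' => ∃ a ≤ N, I a s' ∧ ¬ b.Holds s' := by
  obtain ⟨k, hk⟩ : ∃ k, k = N - a := ⟨_, rfl⟩
  induction k generalizing a s with
  | zero =>
    obtain rfl : a = N := by omega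
    refine ⟨s, _, .loop_false (hend s hI), ?_, a, le_rfl, hI, hend s hI⟩
    have := b.cost_le hV (hb _ _ hI)
    simp only [Nat.sub_self]
    omega
  | succ k ih =>
    have hc := b.cost_le hV (hb _ _ hI)
    by_cases h : b.Holds s
    · obtain ⟨s', t, h1, h2, h3⟩ := hbody a s (by omega) hI h
      obtain ⟨s'', u, h4, h5, h6⟩ := ih (a := a + 1) (by omega) h3 (by omega)
      refine ⟨s'', _, .loop_true h h1 h4, ?_, h6⟩
      have : N - a + 1 = (N - (a + 1) + 1) + 1 := by omega
      rw [this, Nat.add_mul]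
      omega
    · refine ⟨s, _, .loop_false h, ?_, a, ha, hI, h⟩
      nlinarith

/-! ### The program

Register 1 holds `M = n² + 1`, register 3 holds `M ^ t` with `t` the bit length of `n`, register 4
the current word `w` (plus one), register 5 its remaining digits, register 6 the number of
processed digits, and register 7 the current digit. Registers `8 + 2 i` and `9 + 2 j` hold the last
word which used row `i` and column `j`. The cells `M` and `M + 1` hold the sum over the words
and the current product. -/

/-- The register with a fixed address. -/
abbrev fixedReg (k : ℕ) : NatExpr := .reg (.lit k)

abbrev rowAddr : NatExpr :=
  .add (.lit 8) (.mul (.lit 2) (.div (.sub (fixedReg 7) (.lit 1)) (fixedReg 0)))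

abbrev colAddr : NatExpr :=
  .add (.lit 9) (.mul (.lit 2) (.mod (.sub (fixedReg 7) (.lit 1)) (fixedReg 0)))

/-- `1` if the stamp at address `a` differs from (is less than) the current one, else `0`. -/
abbrev unusedFlag (a : NatExpr) : NatExpr :=
  .div (.sub (fixedReg 4) (.reg a)) (.sub (fixedReg 4) (.reg a))

abbrev prodAddr : NatExpr := .add (fixedReg 1) (.lit 1)

/-- Over the first `k` digits the denominators multiply to `m ^ k · n (n-1) ⋯ (n-k+1) · k!`, the
normalization of a sum over ordered sequences of `k` cells. -/
abbrev digitFactor : NumExpr :=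
  .div (.mul (.sub (.num (fixedReg 7)) (.num (.lit 0)))
      (.cast (.mul (unusedFlag rowAddr) (unusedFlag colAddr))))
    (.mul (.num (.lit 0))
      (.cast (.mul (.sub (fixedReg 0) (fixedReg 6)) (.add (fixedReg 6) (.lit 1)))))

/-- The factor is computed before the stamps are written; otherwise each cell would conflict with
itself. -/
def digitStep : Program :=
  .seq (.setReg (.lit 7) (.mod (fixedReg 5) (fixedReg 1))) <|
  .seq (.setReg (.lit 5) (.div (fixedReg 5) (fixedReg 1))) <|
  .seq (.setNum prodAddr (.mul (.num prodAddr) digitFactor)) <|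
  .seq (.setReg rowAddr (fixedReg 4)) <|
  .seq (.setReg colAddr (fixedReg 4)) <|
  .setReg (.lit 6) (.add (fixedReg 6) (.lit 1))

/-- The stamp of the word `w` is `w + 1`, so it differs from the initial zeros and from the stamps
of all earlier words; nothing has to be cleared between words. -/
def wordInit : Program :=
  .seq (.setReg (.lit 5) (fixedReg 4)) <|
  .seq (.setReg (.lit 6) (.lit 0)) <|
  .seq (.setReg (.lit 4) (.add (fixedReg 4) (.lit 1))) <|
  .setNum prodAddr (.cast (.lit 1))

def wordFinish : Program :=
  .setNum (fixedReg 1) (.add (.num (fixedReg 1)) (.num prodAddr))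

def wordStep : Program :=
  .seq wordInit (.seq (.loop (.lt (.lit 0) (fixedReg 5)) digitStep) wordFinish)

def sizeStep : Program :=
  .seq (.setReg (.lit 2) (.div (fixedReg 2) (.lit 2)))
    (.setReg (.lit 3) (.mul (fixedReg 3) (fixedReg 1)))

/-- Register 0 serves as the counter, running from `n` down to zero, so the accumulated factor is `m
^ n n!`. -/
def scaleStep : Program :=
  .seq (.setNum (fixedReg 1) (.mul (.num (fixedReg 1)) (.mul (.num (.lit 0)) (.cast (fixedReg 0)))))
    (.setReg (.lit 0) (.sub (fixedReg 0) (.lit 1)))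

def initStep : Program :=
  .seq (.setReg (.lit 1) (.add (.mul (fixedReg 0) (fixedReg 0)) (.lit 1))) <|
  .seq (.setReg (.lit 2) (fixedReg 0)) <|
  .setReg (.lit 3) (.lit 1)

def permanentProgram : Program :=
  .seq initStep <|
  .seq (.loop (.lt (.lit 0) (fixedReg 2)) sizeStep) <|
  .seq (.loop (.lt (fixedReg 4) (fixedReg 3)) wordStep) <|
  .seq (.loop (.lt (.lit 0) (fixedReg 0)) scaleStep) <|
  .setNum (.lit 0) (.num (fixedReg 1))

/-- The digit of index `b` of `w` in base `M`. -/
def wordDigit (M w b : ℕ) : ℕ := w / M ^ b % M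

/-- The row of the cell with index `d` (counted from one) of an `n × n` matrix. -/
def cellRow (n d : ℕ) : ℕ := (d - 1) / n

def cellCol (n d : ℕ) : ℕ := (d - 1) % n

open Classical in
/-- The factor of the digit of index `b` of the word `w`. -/
noncomputable def wordFactor (n : ℕ) (x : ℕ → ℂ) (w b : ℕ) : ℂ :=
  (x (wordDigit (n * n + 1) w b) - x 0) *
    (if ∃ c < b, cellRow n (wordDigit (n * n + 1) w c) = cellRow n (wordDigit (n * n + 1) w b) ∨
      cellCol n (wordDigit (n * n + 1) w c) = cellCol n (wordDigit (n * n + 1) w b) then 0 else 1) /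
    (x 0 * (((n - b) * (b + 1) : ℕ) : ℂ))

/-- The product over the digits of `w` up to the leading one. -/
noncomputable def wordProd (n : ℕ) (x : ℕ → ℂ) (w a : ℕ) : ℂ :=
  ∏ b ∈ Finset.range a, if w / (n * n + 1) ^ b = 0 then 1 else wordFactor n x w b

/-- The invariant of the loop over the digits of `w`. -/
structure DigitInv (n V : ℕ) (x : ℕ → ℂ) (W w : ℕ) (S : ℂ) (a : ℕ) (s : MemState) : Prop where
  bound : s.BoundedBy V
  reg0 : s.reg 0 = n
  reg1 : s.reg 1 = n * n + 1
  reg3 : s.reg 3 = W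
  reg4 : s.reg 4 = w + 1
  reg5 : s.reg 5 = w / (n * n + 1) ^ a
  reg6 : s.reg 6 = a
  row : ∀ i, s.reg (8 + 2 * i) ≤ w + 1 ∧
    (s.reg (8 + 2 * i) = w + 1 ↔ ∃ c < a, cellRow n (wordDigit (n * n + 1) w c) = i)
  col : ∀ i, s.reg (9 + 2 * i) ≤ w + 1 ∧
    (s.reg (9 + 2 * i) = w + 1 ↔ ∃ c < a, cellCol n (wordDigit (n * n + 1) w c) = i)
  input : ∀ i ≤ n * n, s.num i = x i
  sum : s.num (n * n + 1) = S
  prod : s.num (n * n + 2) = wordProd n x w a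

/-- Since `0 / 0 = 0` for natural numbers, the quotient is an indicator that needs no branch. -/
theorem unusedFlag_value (w r : ℕ) (h : r ≤ w) :
    (w - r) / (w - r) = if r = w then 0 else 1 := by
  split_ifs with h1
  · simp [h1]
  · exact Nat.div_self (by omega)

/-- The effect of one round of the loop over the digits. -/
theorem digitStep_effect {n V W w a : ℕ} {x : ℕ → ℂ} {S : ℂ} {s : MemState} (hV : 2 ≤ V)
    (hMV : n * n + 1 ≤ V) (h : DigitInv n V x W w S a s) {d q i j : ℕ} {f : ℂ}
    (hd : d = w / (n * n + 1) ^ a % (n * n + 1)) (hq : q = w / (n * n + 1) ^ a / (n * n + 1))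
    (hi : i = (d - 1) / n) (hj : j = (d - 1) % n)
    (hf : f = (s.num d - s.num 0) * ((((w + 1 - s.reg (8 + 2 * i)) / (w + 1 - s.reg (8 + 2 * i))) *
      ((w + 1 - s.reg (9 + 2 * j)) / (w + 1 - s.reg (9 + 2 * j))) : ℕ) : ℂ) /
      (s.num 0 * (((n - a) * (a + 1) : ℕ) : ℂ))) :
    Halts digitStep s (opCost 1000 V) fun s' => s' =
      { reg := Function.update (Function.update (Function.update (Function.update
          (Function.update s.reg 7 d) 5 q) (8 + 2 * i) (w + 1)) (9 + 2 * j) (w + 1)) 6 (a + 1)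
        num := Function.update s.num (n * n + 2) (s.num (n * n + 2) * f) } := by
  have hwV : w + 1 ≤ V := h.reg4 ▸ h.bound 4
  have hdV : d ≤ V := hd ▸ (Nat.mod_lt _ (Nat.succ_pos _)).le.trans hMV
  have hqV : q ≤ V := by
    rw [hq]
    exact (Nat.div_le_self _ _).trans ((Nat.div_le_self _ _).trans (by omega))
  -- Row stamps are at even and column stamps at odd addresses from 8 on, so the writes never
  -- overwrite the control registers.
  have n5 : 4 ≠ 8 + 2 * i := by omega
  have n6 : 7 ≠ 8 + 2 * i := by omega
  have n7 : 0 ≠ 8 + 2 * i := by omega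
  have n8 : 6 ≠ 8 + 2 * i := by omega
  have n9 : 6 ≠ 9 + 2 * j := by omega
  obtain ⟨r, y⟩ := s
  have hb := h.bound
  obtain ⟨-, h0, h1, -, h4, h5, h6, -, -, -, -, -⟩ := h
  dsimp only at *
  refine Halts.mono (T := opCost digitStep.weight V) ?_
    (opCost_mono (by simp [digitStep, Program.weight, NatExpr.weight, NumExpr.weight]) V)
    fun _ h => h
  unfold digitStep
  refine Halts.seqSetReg (D := 7) (E := d) hV hb rfl (by simp [NatExpr.eval, h1, h5, hd]) hdV
    fun hb => ?_
  refine Halts.seqSetReg (D := 5) (E := q) hV hb rfl (by simp [NatExpr.eval, h1, h5, hq]) hqV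
    fun hb => ?_
  refine Halts.seqSetNum (D := n * n + 2) (E := y (n * n + 2) * f) hV hb
    (by simp [NatExpr.eval, h1]) ?_ fun hb => ?_
  · have e : ∀ b, b ≠ 7 → b ≠ 5 →
        Function.update (Function.update r 7 d) 5 q b = r b := fun b h7 h5 => by
      rw [Function.update_of_ne h5, Function.update_of_ne h7]
    have e7 : Function.update (Function.update r 7 d) 5 q 7 = d := by simp
    simp only [NumExpr.eval, NatExpr.eval, e7, e 0 (by simp) (by simp), e 1 (by simp) (by simp),
      e 4 (by simp) (by simp), e 6 (by simp) (by simp), h0, h1, h4, h6, ← hi, ← hj,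
      e (8 + 2 * i) (by omega) (by omega), e (9 + 2 * j) (by omega) (by omega), hf]
  refine Halts.seqSetReg (D := 8 + 2 * i) (E := w + 1) hV hb
    (by simp [NatExpr.eval, h0, hi]) (by simp [NatExpr.eval, h4]) hwV fun hb => ?_
  refine Halts.seqSetReg (D := 9 + 2 * j) (E := w + 1) hV hb
    (by simp [NatExpr.eval, h0, hj, n6, n7]) (by simp [NatExpr.eval, h4, n5]) hwV fun hb => ?_
  refine Halts.setReg hV hb ?_
  simp [NatExpr.eval, h6, n8, n9]

theorem digitStep_halts {n V W w a : ℕ} {x : ℕ → ℂ} {S : ℂ} {s : MemState} (hV : 2 ≤ V)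
    (hMV : n * n + 1 ≤ V) (haV : a + 1 ≤ V) (h : DigitInv n V x W w S a s) (h5 : 0 < s.reg 5) :
    Halts digitStep s (opCost 1000 V) (DigitInv n V x W w S (a + 1)) := by
  obtain ⟨d, hd⟩ : ∃ d, d = wordDigit (n * n + 1) w a := ⟨_, rfl⟩
  refine (digitStep_effect hV hMV h hd rfl rfl rfl rfl).mono le_rfl ?_
  rintro _ rfl
  have hwV : w + 1 ≤ V := h.reg4 ▸ h.bound 4
  have hdV : d ≤ n * n := by
    rw [hd]; exact Nat.lt_succ_iff.1 (Nat.mod_lt _ (Nat.succ_pos _))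
  have hqV : w / (n * n + 1) ^ a / (n * n + 1) ≤ V :=
    (Nat.div_le_self _ _).trans ((Nat.div_le_self _ _).trans (by omega))
  have hlt : ∀ P : ℕ → Prop, (∃ c < a + 1, P c) ↔ (P a ∨ ∃ c < a, P c) := by
    intro P
    constructor
    · rintro ⟨c, hc, h⟩
      rcases Nat.lt_succ_iff_lt_or_eq.1 hc with h1 | rfl
      exacts [.inr ⟨c, h1, ‹_›⟩, .inl ‹_›]
    · rintro (h | ⟨c, hc, h⟩)
      exacts [⟨a, by omega, h⟩, ⟨c, by omega, h⟩]
  obtain ⟨r, y⟩ := s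
  dsimp only at *
  have hrow : (w + 1 - r (8 + 2 * ((d - 1) / n))) / (w + 1 - r (8 + 2 * ((d - 1) / n))) =
      if ∃ c < a, cellRow n (wordDigit (n * n + 1) w c) = cellRow n d then 0 else 1 := by
    rw [unusedFlag_value _ _ (h.row _).1]
    exact if_congr (h.row _).2 rfl rfl
  have hcol : (w + 1 - r (9 + 2 * ((d - 1) % n))) / (w + 1 - r (9 + 2 * ((d - 1) % n))) =
      if ∃ c < a, cellCol n (wordDigit (n * n + 1) w c) = cellCol n d then 0 else 1 := by
    rw [unusedFlag_value _ _ (h.col _).1]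
    exact if_congr (h.col _).2 rfl rfl
  refine ⟨?_, ?_, ?_, ?_, ?_, ?_, ?_, ?_, ?_, ?_, ?_, ?_⟩
  · exact ((((MemState.BoundedBy.update h.bound (hdV.trans (by omega))).update hqV).update
      hwV).update hwV).update haV
  · have := h.reg0
    simpa [show (0 : ℕ) ≠ 9 + 2 * ((d - 1) % n) by omega,
      show (0 : ℕ) ≠ 8 + 2 * ((d - 1) / n) by omega] using this
  · have := h.reg1
    simpa [show (1 : ℕ) ≠ 9 + 2 * ((d - 1) % n) by omega,
      show (1 : ℕ) ≠ 8 + 2 * ((d - 1) / n) by omega] using this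
  · have := h.reg3
    simpa [show (3 : ℕ) ≠ 9 + 2 * ((d - 1) % n) by omega,
      show (3 : ℕ) ≠ 8 + 2 * ((d - 1) / n) by omega] using this
  · have := h.reg4
    simpa [show (4 : ℕ) ≠ 9 + 2 * ((d - 1) % n) by omega,
      show (4 : ℕ) ≠ 8 + 2 * ((d - 1) / n) by omega] using this
  · simp [show (5 : ℕ) ≠ 9 + 2 * ((d - 1) % n) by omega,
      show (5 : ℕ) ≠ 8 + 2 * ((d - 1) / n) by omega, Nat.div_div_eq_div_mul, pow_succ]
  · simp
  · intro i
    have hi := h.row i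
    dsimp only at hi ⊢
    rw [hlt, ← hd, Function.update_of_ne (by omega), Function.update_of_ne (by omega)]
    by_cases e : i = (d - 1) / n
    · subst e
      simp [cellRow]
    · rw [Function.update_of_ne (by omega), Function.update_of_ne (by omega),
        Function.update_of_ne (by omega)]
      have : ¬ cellRow n d = i := fun h => e h.symm
      simpa [this] using hi
  · intro i
    have hi := h.col i
    dsimp only at hi ⊢
    rw [hlt, ← hd, Function.update_of_ne (by omega)]
    by_cases e : i = (d - 1) % n
    · subst e
      simp [cellCol]
    · rw [Function.update_of_ne (by omega), Function.update_of_ne (by omega),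
        Function.update_of_ne (by omega), Function.update_of_ne (by omega)]
      have : ¬ cellCol n d = i := fun h => e h.symm
      simpa [this] using hi
  · intro i hi
    dsimp only
    rw [Function.update_of_ne (by omega)]
    exact h.input i hi
  · dsimp only
    rw [Function.update_of_ne (by omega)]
    exact h.sum
  · have hp := h.prod
    have h5' := h.reg5
    dsimp only at hp h5' ⊢
    rw [Function.update_self, hp, wordProd, wordProd, Finset.prod_range_succ, if_neg (by omega),
      hrow, hcol]
    congr 1
    unfold wordFactor
    have e1 := h.input d hdV
    have e2 := h.input 0 (Nat.zero_le _)
    dsimp only at e1 e2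
    rw [← hd, e1, e2]
    congr 2
    -- The machine multiplies a row flag and a column flag, whereas `wordFactor` tests one
    -- disjunction.
    by_cases p : ∃ c < a, cellRow n (wordDigit (n * n + 1) w c) = cellRow n d
    · have o : ∃ c < a, cellRow n (wordDigit (n * n + 1) w c) = cellRow n d ∨
          cellCol n (wordDigit (n * n + 1) w c) = cellCol n d :=
        p.imp fun c h => ⟨h.1, Or.inl h.2⟩
      simp only [if_pos p, if_pos o]
      simp
    · by_cases q : ∃ c < a, cellCol n (wordDigit (n * n + 1) w c) = cellCol n d
      · have o : ∃ c < a, cellRow n (wordDigit (n * n + 1) w c) = cellRow n d ∨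
            cellCol n (wordDigit (n * n + 1) w c) = cellCol n d :=
          q.imp fun c h => ⟨h.1, Or.inr h.2⟩
        simp only [if_pos q, if_pos o]
        simp
      · rw [if_neg p, if_neg q, if_neg]
        · simp
        · rintro ⟨c, hc, h1 | h1⟩
          exacts [p ⟨c, hc, h1⟩, q ⟨c, hc, h1⟩]

/-! ### Correctness of the loop over the words -/

/-- The invariant of the loop over the words. -/
structure WordInv (n V : ℕ) (x : ℕ → ℂ) (t w : ℕ) (s : MemState) : Prop where
  bound : s.BoundedBy V
  reg0 : s.reg 0 = n
  reg1 : s.reg 1 = n * n + 1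
  reg3 : s.reg 3 = (n * n + 1) ^ t
  reg4 : s.reg 4 = w
  stamp : ∀ a, 8 ≤ a → s.reg a ≤ w
  input : ∀ i ≤ n * n, s.num i = x i
  sum : s.num (n * n + 1) = ∑ v ∈ Finset.range w, wordProd n x v t

theorem wordInit_halts {n V t w : ℕ} {x : ℕ → ℂ} {s : MemState} (hV : 2 ≤ V)
    (hWV : (n * n + 1) ^ t ≤ V) (h : WordInv n V x t w s) (hw : w < (n * n + 1) ^ t) :
    Halts wordInit s (opCost 1000 V) (DigitInv n V x ((n * n + 1) ^ t) w
      (∑ v ∈ Finset.range w, wordProd n x v t) 0) := by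
  obtain ⟨r, y⟩ := s
  obtain ⟨hb, h0, h1, h3, h4, hst, hin, hsum⟩ := h
  dsimp only at *
  refine Halts.mono (T := opCost wordInit.weight V) ?_
    (opCost_mono (by simp [wordInit, Program.weight, NatExpr.weight, NumExpr.weight]) V)
    fun _ h => h
  unfold wordInit
  refine Halts.seqSetReg (D := 5) (E := w) hV hb rfl (by simp [NatExpr.eval, h4]) (by omega)
    fun hb => ?_
  refine Halts.seqSetReg (D := 6) (E := 0) hV hb rfl (by simp [NatExpr.eval]) (by omega)
    fun hb => ?_
  refine Halts.seqSetReg (D := 4) (E := w + 1) hV hb rfl (by simp [NatExpr.eval, h4]) (by omega)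
    fun hb => ?_
  refine Halts.setNum hV hb ?_
  have e : ∀ b, 8 ≤ b → Function.update (Function.update (Function.update r 5 w) 6 0) 4 (w + 1) b
      = r b := fun b hb => by
    rw [Function.update_of_ne (by omega), Function.update_of_ne (by omega),
      Function.update_of_ne (by omega)]
  have hD : prodAddr.eval ⟨Function.update (Function.update (Function.update r 5 w) 6 0) 4 (w + 1), y⟩
      = n * n + 2 := by
    simp [NatExpr.eval, h1]
  rw [hD]
  refine ⟨hb, by simpa, by simpa, by simpa, by simp, by simp, by simp, ?_, ?_, ?_, ?_, ?_⟩
  · intro i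
    have := hst (8 + 2 * i) (by omega)
    dsimp only
    rw [e _ (by omega)]
    exact ⟨by omega, iff_of_false (by omega) (by simp)⟩
  · intro i
    have := hst (9 + 2 * i) (by omega)
    dsimp only
    rw [e _ (by omega)]
    exact ⟨by omega, iff_of_false (by omega) (by simp)⟩
  · intro i hi
    dsimp only
    rw [Function.update_of_ne (by omega)]
    exact hin i hi
  · dsimp only
    rw [Function.update_of_ne (by omega)]
    exact hsum
  · simp [wordProd, NumExpr.eval, NatExpr.eval]

/-- Beyond the leading digit all factors are one. This reconciles the loop, which stops at the
leading digit, with the formula of fixed length `t`. -/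
theorem wordProd_eq_of_le {n w a t : ℕ} (x : ℕ → ℂ) (hat : a ≤ t)
    (h : w / (n * n + 1) ^ a = 0) : wordProd n x w a = wordProd n x w t := by
  unfold wordProd
  refine Finset.prod_subset (Finset.range_mono hat) fun b _ hb => if_pos ?_
  have hab : a ≤ b := by simpa using hb
  rw [Nat.div_eq_zero_iff] at h ⊢
  have : 0 < (n * n + 1) ^ a := by positivity
  have : (n * n + 1) ^ a ≤ (n * n + 1) ^ b := Nat.pow_le_pow_right (Nat.succ_pos _) hab
  omega

theorem wordFinish_halts {n V t w a : ℕ} {x : ℕ → ℂ} {s : MemState} (hV : 2 ≤ V) (hat : a ≤ t)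
    (h : DigitInv n V x ((n * n + 1) ^ t) w (∑ v ∈ Finset.range w, wordProd n x v t) a s)
    (h5 : ¬ 0 < s.reg 5) :
    Halts wordFinish s (opCost 1000 V) (WordInv n V x t (w + 1)) := by
  unfold wordFinish
  refine Halts.mono (Halts.setNum (Q := WordInv n V x t (w + 1)) hV h.bound ?_)
    (opCost_mono (by simp [NatExpr.weight, NumExpr.weight]) V) fun _ h => h
  have hp : prodAddr.eval s = n * n + 2 := by simp [NatExpr.eval, h.reg1]
  have hr : (fixedReg 1).eval s = n * n + 1 := h.reg1
  simp only [NumExpr.eval, hp, hr]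
  refine ⟨h.bound, h.reg0, h.reg1, h.reg3, h.reg4, fun b hb => ?_, fun i hi => ?_, ?_⟩
  -- Every address from 8 on is a row stamp or a column stamp, according to its parity.
  · rcases Nat.even_or_odd' b with ⟨c, rfl | rfl⟩
    · have := (h.row (c - 4)).1
      rwa [show 8 + 2 * (c - 4) = 2 * c by omega] at this
    · have := (h.col (c - 4)).1
      rwa [show 9 + 2 * (c - 4) = 2 * c + 1 by omega] at this
  · dsimp only
    rw [Function.update_of_ne (by omega)]
    exact h.input i hi
  · dsimp only
    have h0 : w / (n * n + 1) ^ a = 0 := by have := h.reg5; omega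
    rw [Function.update_self, h.sum, h.prod, wordProd_eq_of_le x hat h0, Finset.sum_range_succ]

theorem wordStep_halts {n V t w : ℕ} {x : ℕ → ℂ} {s : MemState} (hV : 2 ≤ V)
    (hMV : n * n + 1 ≤ V) (htV : t + 1 ≤ V) (hWV : (n * n + 1) ^ t ≤ V)
    (h : WordInv n V x t w s) (h4 : s.reg 4 < s.reg 3) :
    Halts wordStep s ((t + 2) * opCost 5000 V) (WordInv n V x t (w + 1)) := by
  have hw : w < (n * n + 1) ^ t := by rwa [h.reg3, h.reg4] at h4
  have hinit := wordInit_halts hV hWV h hw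
  have hloop : ∀ s, DigitInv n V x ((n * n + 1) ^ t) w
      (∑ v ∈ Finset.range w, wordProd n x v t) 0 s →
      Halts (.loop (.lt (.lit 0) (fixedReg 5)) digitStep) s
        ((t - 0 + 1) * (opCost (BranchTest.lt (.lit 0) (fixedReg 5)).weight V + opCost 1000 V + 1))
        fun s' => ∃ a ≤ t, DigitInv n V x ((n * n + 1) ^ t) w
          (∑ v ∈ Finset.range w, wordProd n x v t) a s' ∧
          ¬ (BranchTest.lt (.lit 0) (fixedReg 5)).Holds s' := by
    intro s hs
    refine Halts.loop hV (fun a s h => h.bound) ?_ ?_ (Nat.zero_le t) hs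
    · intro s hs
      have := hs.reg5
      rw [Nat.div_eq_of_lt hw] at this
      simp [BranchTest.Holds, NatExpr.eval, this]
    · intro a s ha hs hb
      exact digitStep_halts hV hMV (by omega) hs hb
  refine (Halts.seq (hinit.mono le_rfl fun s' hs' => Halts.seq ((hloop s' hs').mono le_rfl
    fun s'' ⟨a, hat, hs'', hb⟩ => wordFinish_halts hV hat hs'' hb))).mono ?_ fun _ h => h
  have e1 := (opCost_add_le (BranchTest.lt (.lit 0) (fixedReg 5)).weight 1000 V).trans
    (opCost_mono (b := 2000) (by simp [BranchTest.weight, NatExpr.weight]) V)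
  have e2 : opCost 1000 V + opCost 1000 V + 2 ≤ opCost 5000 V := by
    unfold opCost
    nlinarith [Nat.zero_le V.size]
  have e3 := Nat.mul_le_mul_left (t - 0 + 1) (e1.trans (opCost_mono (b := 5000) (by norm_num) V))
  rw [Nat.sub_zero] at e3 ⊢
  rw [show t + 2 = (t + 1) + 1 by omega, Nat.add_mul (t + 1) 1]
  omega

/-! ### The auxiliary loops and the correctness of the whole program -/

/-- The invariant of the loop computing `M ^ t`. -/
structure SizeInv (n V : ℕ) (x : ℕ → ℂ) (a : ℕ) (s : MemState) : Prop where
  bound : s.BoundedBy V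
  reg0 : s.reg 0 = n
  reg1 : s.reg 1 = n * n + 1
  reg2 : s.reg 2 = n / 2 ^ a
  reg3 : s.reg 3 = (n * n + 1) ^ a
  zero : ∀ a, 4 ≤ a → s.reg a = 0
  num : s.num = x

theorem sizeStep_halts {n V a : ℕ} {x : ℕ → ℂ} {s : MemState} (hV : 2 ≤ V) (hnV : n ≤ V)
    (ha : a < Nat.size n) (hWV : (n * n + 1) ^ Nat.size n ≤ V) (h : SizeInv n V x a s) :
    Halts sizeStep s (opCost 1000 V) (SizeInv n V x (a + 1)) := by
  obtain ⟨r, y⟩ := s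
  obtain ⟨hb, h0, h1, h2, h3, hz, hx⟩ := h
  dsimp only at *
  have hW : (n * n + 1) ^ (a + 1) ≤ V :=
    (Nat.pow_le_pow_right (Nat.succ_pos _) ha).trans hWV
  refine Halts.mono (T := opCost sizeStep.weight V) ?_
    (opCost_mono (by simp [sizeStep, Program.weight, NatExpr.weight]) V) fun _ h => h
  unfold sizeStep
  refine Halts.seqSetReg (D := 2) (E := n / 2 ^ (a + 1)) hV hb rfl
    (by simp [NatExpr.eval, h2, Nat.div_div_eq_div_mul, pow_succ])
    ((Nat.div_le_self _ _).trans hnV) fun hb => ?_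
  refine Halts.setReg hV hb ?_
  have e1 : (NatExpr.mul (fixedReg 3) (fixedReg 1)).eval
      ⟨Function.update r 2 (n / 2 ^ (a + 1)), y⟩ = (n * n + 1) ^ (a + 1) := by
    simp [NatExpr.eval, h3, h1, pow_succ]
  rw [e1]
  refine ⟨hb.update hW, by simpa, by simpa, by simp [NatExpr.eval], by simp [NatExpr.eval],
    fun b hb => ?_, hx⟩
  simp only [NatExpr.eval]
  rw [Function.update_of_ne (by omega), Function.update_of_ne (by omega), hz b hb]

/-- The invariant of the final loop, which multiplies the sum `S` by `n! m ^ n`. -/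
structure ScaleInv (n V : ℕ) (m S : ℂ) (a : ℕ) (s : MemState) : Prop where
  bound : s.BoundedBy V
  reg0 : s.reg 0 = n - a
  reg1 : s.reg 1 = n * n + 1
  mean : s.num 0 = m
  value : s.num (n * n + 1) = S * (m ^ a * (n.descFactorial a : ℂ))

theorem scaleStep_halts {n V a : ℕ} {m S : ℂ} {s : MemState} (hV : 2 ≤ V) (ha : a < n)
    (h : ScaleInv n V m S a s) : Halts scaleStep s (opCost 1000 V) (ScaleInv n V m S (a + 1)) := by
  obtain ⟨r, y⟩ := s
  obtain ⟨hb, h0, h1, hm, hS⟩ := h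
  dsimp only at *
  have hnV : n - a ≤ V := h0 ▸ hb 0
  refine Halts.mono (T := opCost scaleStep.weight V) ?_
    (opCost_mono (by simp [scaleStep, Program.weight, NatExpr.weight, NumExpr.weight]) V)
    fun _ h => h
  unfold scaleStep
  refine Halts.seqSetNum (D := n * n + 1)
    (E := S * (m ^ (a + 1) * (n.descFactorial (a + 1) : ℂ))) hV hb
    (by simp [NatExpr.eval, h1]) ?_ fun hb => ?_
  · simp only [NumExpr.eval, NatExpr.eval, h1, hS, hm, h0, Nat.descFactorial_succ]
    push_cast
    ring
  refine Halts.setReg hV hb ?_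
  have e1 : (NatExpr.sub (fixedReg 0) (.lit 1)).eval
      ⟨r, Function.update y (n * n + 1) (S * (m ^ (a + 1) * (n.descFactorial (a + 1) : ℂ)))⟩
      = n - (a + 1) := by
    simp only [NatExpr.eval, h0]; omega
  rw [e1]
  exact ⟨hb.update (by omega), by simp [NatExpr.eval], by simpa [NatExpr.eval], by simpa, by simp⟩

/-- A bound for the registers of the program on inputs of dimension `n`. -/
def registerBound (n : ℕ) : ℕ := (n * n + 1) ^ Nat.size n + n * n + 3

theorem size_le_self (n : ℕ) : Nat.size n ≤ n := Nat.size_le.2 Nat.lt_two_pow_self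

/-- The assumption on cell `n * n + 1` makes the accumulator start at zero. The number of words, at
most `registerBound n`, dominates the cost. -/
theorem permanentProgram_halts (n : ℕ) (x : ℕ → ℂ) (hx : x (n * n + 1) = 0) :
    Halts permanentProgram ⟨fun a => if a = 0 then n else 0, x⟩
      (4 * (registerBound n + 1) * (Nat.size n + 3) * (opCost 5000 (registerBound n) + 1))
      fun s => s.num 0 = (∑ w ∈ Finset.range ((n * n + 1) ^ Nat.size n),
        wordProd n x w (Nat.size n)) * (x 0 ^ n * (n.factorial : ℂ)) := by
  obtain ⟨V, hVdef⟩ : ∃ V, V = registerBound n := ⟨_, rfl⟩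
  obtain ⟨t, ht⟩ : ∃ t, t = Nat.size n := ⟨_, rfl⟩
  obtain ⟨W, hW⟩ : ∃ W, W = (n * n + 1) ^ t := ⟨_, rfl⟩
  have hVW : V = W + n * n + 3 := by rw [hVdef, registerBound, hW, ht]
  have hnn : n ≤ n * n := Nat.le_mul_self n
  have htn : t ≤ n := ht ▸ size_le_self n
  have hV : 2 ≤ V := by omega
  have hnt : n < 2 ^ t := ht ▸ Nat.lt_size_self n
  rw [← hVdef, ← ht, ← hW]
  have hinit : Halts initStep ⟨fun a => if a = 0 then n else 0, x⟩ (opCost 1000 V)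
      (SizeInv n V x 0) := by
    refine Halts.mono (T := opCost initStep.weight V) ?_
      (opCost_mono (by simp [initStep, Program.weight, NatExpr.weight]) V) fun _ h => h
    have hb : MemState.BoundedBy ⟨fun a => if a = 0 then n else 0, x⟩ V := by
      intro a
      dsimp only
      split_ifs <;> omega
    unfold initStep
    refine Halts.seqSetReg (D := 1) (E := n * n + 1) hV hb rfl (by simp [NatExpr.eval])
      (by omega) fun hb => ?_
    refine Halts.seqSetReg (D := 2) (E := n) hV hb rfl (by simp [NatExpr.eval])
      (by omega) fun hb => ?_
    refine Halts.setReg hV hb ?_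
    refine ⟨hb.update (by simp only [NatExpr.eval]; omega), by simp [NatExpr.eval],
      by simp [NatExpr.eval], by simp [NatExpr.eval], by simp [NatExpr.eval], fun b hb => ?_, rfl⟩
    simp only [NatExpr.eval]
    rw [Function.update_of_ne (by omega), Function.update_of_ne (by omega),
      Function.update_of_ne (by omega), if_neg (by omega)]
  have hsize : ∀ s, SizeInv n V x 0 s → Halts (.loop (.lt (.lit 0) (fixedReg 2)) sizeStep) s
      ((t - 0 + 1) * (opCost (BranchTest.lt (.lit 0) (fixedReg 2)).weight V + opCost 1000 V + 1))
      fun s' => ∃ a ≤ t, SizeInv n V x a s' ∧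
        ¬ (BranchTest.lt (.lit 0) (fixedReg 2)).Holds s' := by
    intro s hs
    refine Halts.loop hV (fun a s h => h.bound) ?_ ?_ (Nat.zero_le t) hs
    · intro s hs
      simp [BranchTest.Holds, NatExpr.eval, hs.reg2, Nat.div_eq_of_lt hnt]
    · intro a s ha hs _
      exact sizeStep_halts hV (by omega) (ht ▸ ha) (by rw [← ht, ← hW]; omega) hs
  have hsize' : ∀ s, (∃ a ≤ t, SizeInv n V x a s ∧
      ¬ (BranchTest.lt (.lit 0) (fixedReg 2)).Holds s) → WordInv n V x t 0 s := by
    rintro s ⟨a, ha, hs, hb⟩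
    have h0 : n < 2 ^ a := by
      have : n / 2 ^ a = 0 := by simpa [BranchTest.Holds, NatExpr.eval, hs.reg2] using hb
      rcases Nat.div_eq_zero_iff.1 this with h | h
      · exact absurd h (by positivity)
      · exact h
    -- Leaving the loop means `n < 2 ^ a`, so the number of rounds is exactly the bit length.
    obtain rfl : a = t := le_antisymm ha (ht ▸ Nat.size_le.2 h0)
    refine ⟨hs.bound, hs.reg0, hs.reg1, hs.reg3, hs.zero 4 le_rfl, fun b hb => ?_,
      fun i _ => by rw [hs.num], by simp [hs.num, hx]⟩
    rw [hs.zero b (by omega)]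
  have hword : ∀ s, WordInv n V x t 0 s →
      Halts (.loop (.lt (fixedReg 4) (fixedReg 3)) wordStep) s
      ((W - 0 + 1) * (opCost (BranchTest.lt (fixedReg 4) (fixedReg 3)).weight V +
        (t + 2) * opCost 5000 V + 1))
      fun s' => ∃ a ≤ W, WordInv n V x t a s' ∧
        ¬ (BranchTest.lt (fixedReg 4) (fixedReg 3)).Holds s' := by
    intro s hs
    refine Halts.loop hV (fun a s h => h.bound) ?_ ?_ (Nat.zero_le W) hs
    · intro s hs
      simp [BranchTest.Holds, NatExpr.eval, hs.reg4, hs.reg3, hW]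
    · intro a s ha hs hb
      exact wordStep_halts hV (by omega) (by omega) (by rw [← hW]; omega) hs hb
  set S := ∑ w ∈ Finset.range W, wordProd n x w t with hS
  have hword' : ∀ s, (∃ a ≤ W, WordInv n V x t a s ∧
      ¬ (BranchTest.lt (fixedReg 4) (fixedReg 3)).Holds s) → ScaleInv n V (x 0) S 0 s := by
    rintro s ⟨a, ha, hs, hb⟩
    simp only [BranchTest.Holds, NatExpr.eval, hs.reg4, hs.reg3, ← hW] at hb
    obtain rfl : a = W := by omega
    exact ⟨hs.bound, hs.reg0, hs.reg1, hs.input 0 (Nat.zero_le _), by simp [hs.sum, hS]⟩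
  have hscale : ∀ s, ScaleInv n V (x 0) S 0 s →
      Halts (.loop (.lt (.lit 0) (fixedReg 0)) scaleStep) s
      ((n - 0 + 1) * (opCost (BranchTest.lt (.lit 0) (fixedReg 0)).weight V + opCost 1000 V + 1))
      fun s' => ∃ a ≤ n, ScaleInv n V (x 0) S a s' ∧
        ¬ (BranchTest.lt (.lit 0) (fixedReg 0)).Holds s' := by
    intro s hs
    refine Halts.loop hV (fun a s h => h.bound) ?_ ?_ (Nat.zero_le n) hs
    · intro s hs
      simp [BranchTest.Holds, NatExpr.eval, hs.reg0]
    · intro a s ha hs _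
      exact scaleStep_halts hV ha hs
  have hfinal : ∀ s, (∃ a ≤ n, ScaleInv n V (x 0) S a s ∧
      ¬ (BranchTest.lt (.lit 0) (fixedReg 0)).Holds s) →
      Halts (.setNum (.lit 0) (.num (fixedReg 1))) s (opCost 1000 V)
        fun s => s.num 0 = S * (x 0 ^ n * (n.factorial : ℂ)) := by
    rintro s ⟨a, ha, hs, hb⟩
    simp only [BranchTest.Holds, NatExpr.eval, hs.reg0] at hb
    obtain rfl : a = n := by omega
    refine Halts.mono (Halts.setNum (Q := fun s => s.num 0 = S * (x 0 ^ a * (a.factorial : ℂ)))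
      hV hs.bound ?_) (opCost_mono (by simp [NatExpr.weight, NumExpr.weight]) V) fun _ h => h
    simp [NatExpr.eval, NumExpr.eval, hs.reg1, hs.value, Nat.descFactorial_self]
  refine ((hinit.mono le_rfl fun s hs => ((hsize s hs).mono le_rfl fun s hs =>
    ((hword s (hsize' s hs)).mono le_rfl fun s hs => ((hscale s (hword' s hs)).mono le_rfl
      fun s hs => hfinal s hs).seq).seq).seq).seq).mono ?_ fun _ h => h
  obtain ⟨c, hc⟩ : ∃ c, c = opCost 5000 V := ⟨_, rfl⟩
  have w1 : opCost 1000 V ≤ c := hc ▸ opCost_mono (by norm_num) V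
  have w2 : ∀ b : BranchTest, b.weight ≤ 1000 → opCost b.weight V + opCost 1000 V + 1 ≤ c :=
    fun b hb => hc ▸ (opCost_add_le _ _ _).trans (opCost_mono (by omega) V)
  have w3 : opCost (BranchTest.lt (fixedReg 4) (fixedReg 3)).weight V + 1 ≤ c := by
    have := w2 (BranchTest.lt (fixedReg 4) (fixedReg 3)) (by simp [BranchTest.weight, NatExpr.weight])
    omega
  rw [← hc, Nat.sub_zero, Nat.sub_zero, Nat.sub_zero]
  have f1 := Nat.mul_le_mul_left (t + 1) (w2 (BranchTest.lt (.lit 0) (fixedReg 2))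
    (by simp [BranchTest.weight, NatExpr.weight]))
  have f2 := Nat.mul_le_mul_left (n + 1) (w2 (BranchTest.lt (.lit 0) (fixedReg 0))
    (by simp [BranchTest.weight, NatExpr.weight]))
  have f3 : (W + 1) * (opCost (BranchTest.lt (fixedReg 4) (fixedReg 3)).weight V +
      (t + 2) * c + 1) ≤ (W + 1) * ((t + 3) * c) :=
    Nat.mul_le_mul_left _ (by rw [show (t + 3) * c = (t + 2) * c + c by ring]; omega)
  have g1 : (t + 1) * c ≤ (V + 1) * ((t + 3) * c) := by
    calc (t + 1) * c ≤ 1 * ((t + 3) * c) := by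
          rw [one_mul]; exact Nat.mul_le_mul_right c (by omega)
      _ ≤ _ := Nat.mul_le_mul_right _ (by omega)
  have g2 : (n + 1) * c ≤ (V + 1) * ((t + 3) * c) :=
    Nat.mul_le_mul (by omega) (Nat.le_mul_of_pos_left c (by omega))
  have g3 : (W + 1) * ((t + 3) * c) ≤ (V + 1) * ((t + 3) * c) :=
    Nat.mul_le_mul_right _ (by omega)
  have g4 : 3 * c ≤ (V + 1) * ((t + 3) * c) := by
    calc 3 * c ≤ 1 * ((t + 3) * c) := by
          rw [one_mul]; exact Nat.mul_le_mul_right c (by omega)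
      _ ≤ _ := Nat.mul_le_mul_right _ (by omega)
  have g5 : 4 * (V + 1) * (t + 3) * (c + 1) =
      4 * ((V + 1) * ((t + 3) * c)) + 4 * ((V + 1) * (t + 3)) := by ring
  have g6 : 4 ≤ (V + 1) * (t + 3) := Nat.mul_le_mul (show 2 ≤ V + 1 by omega) (show 2 ≤ t + 3 by omega)
  rw [g5]
  omega

/-! ### The quasi-polynomial running time -/

theorem inputState_num_last (n : ℕ) (m : ℂ) (A : Fin n → Fin n → ℂ) :
    (inputState n m A).num (n * n + 1) = 0 := by
  simp [inputState]

theorem permanentProgram_quasiPolyTime : QuasiPolyTime permanentProgram := by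
  -- The cost turns out to be at most `2 ^ (2 p + L + 45)` with `p = 2 (L + 1)²`. The exponent is
  -- quadratic in `L`, so already the cube of `L + 50` suffices.
  refine ⟨50, fun n m A => ?_⟩
  obtain ⟨s, t, h1, h2, -⟩ := permanentProgram_halts n _ (inputState_num_last n m A)
  refine ⟨s, t, h1, h2.trans ?_⟩
  obtain ⟨L, hL⟩ : ∃ L, L = Nat.log 2 n := ⟨_, rfl⟩
  rw [← hL]
  have hn : n < 2 ^ (L + 1) := hL ▸ Nat.lt_pow_succ_log_self (by norm_num) n
  have hsz : Nat.size n ≤ L + 1 := Nat.size_le.2 hn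
  obtain ⟨p, hp⟩ : ∃ p, p = 2 * (L + 1) * (L + 1) := ⟨_, rfl⟩
  have hnn : n * n + 1 ≤ 2 ^ (2 * (L + 1)) := by
    rw [two_mul, pow_add]
    exact Nat.mul_lt_mul'' hn hn
  have hV : registerBound n ≤ 2 ^ (p + 2) := by
    have e1 : (n * n + 1) ^ Nat.size n ≤ 2 ^ p := by
      calc (n * n + 1) ^ Nat.size n ≤ (n * n + 1) ^ (L + 1) := Nat.pow_le_pow_right (Nat.succ_pos _) hsz
        _ ≤ (2 ^ (2 * (L + 1))) ^ (L + 1) := Nat.pow_le_pow_left hnn _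
        _ = 2 ^ p := by rw [← pow_mul, hp]
    have e2 : 2 ^ (2 * (L + 1)) ≤ 2 ^ p :=
      Nat.pow_le_pow_right (by norm_num) (by rw [hp]; exact Nat.le_mul_of_pos_right _ (Nat.succ_pos L))
    have e3 : 2 ^ 1 ≤ 2 ^ p := Nat.pow_le_pow_right (by norm_num) (by rw [hp]; nlinarith)
    unfold registerBound
    rw [pow_add]
    omega
  have hs : Nat.size (registerBound n) ≤ p + 3 := by
    rw [Nat.size_le]
    exact hV.trans_lt (Nat.pow_lt_pow_right (by norm_num) (by omega))
  have hc : opCost 5000 (registerBound n) + 1 ≤ 2 ^ (p + 36) := by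
    have : p < 2 ^ p := Nat.lt_two_pow_self
    have : opCost 5000 (registerBound n) ≤ 5000 * (2 + 5000 * (p + 3)) := by
      unfold opCost; gcongr
    rw [pow_add]
    norm_num
    omega
  have hV' : registerBound n + 1 ≤ 2 ^ (p + 3) := by
    have := Nat.one_le_two_pow (n := p + 2)
    rw [pow_succ]; omega
  have ht : Nat.size n + 3 ≤ 2 ^ (L + 4) := by
    have : L + 4 < 2 ^ (L + 4) := Nat.lt_two_pow_self
    omega
  calc 4 * (registerBound n + 1) * (Nat.size n + 3) * (opCost 5000 (registerBound n) + 1)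
      ≤ 2 ^ 2 * 2 ^ (p + 3) * 2 ^ (L + 4) * 2 ^ (p + 36) := by
        gcongr
        norm_num
    _ = 2 ^ (2 * p + L + 45) := by rw [← pow_add, ← pow_add, ← pow_add]; congr 1; omega
    _ ≤ 2 ^ ((L + 50) ^ 50) := by
        refine Nat.pow_le_pow_right (by norm_num) (le_trans ?_
          (Nat.pow_le_pow_right (show 0 < L + 50 by omega) (show 3 ≤ 50 by norm_num)))
        rw [hp]
        nlinarith [Nat.zero_le L, Nat.zero_le (L * L), Nat.zero_le (L * L * L)]

/-! ### Expansion of the permanent -/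

/-- The sum of `∏ i ∈ S, B (σ i) i` over permutations `σ` and sets `S` of `k` columns. It equals
`(n - k)!` times the sum of the permanents of the `k × k` submatrices of `B`. -/
noncomputable def minorSum {n : ℕ} (B : Fin n → Fin n → ℂ) (k : ℕ) : ℂ :=
  ∑ σ : Equiv.Perm (Fin n), ∑ S ∈ Finset.powersetCard k Finset.univ, ∏ i ∈ S, B (σ i) i

/-- Multiply out the product for each permutation; `S` is the set of columns where the entry of `B`
is chosen. -/
theorem permanent_add_const {n : ℕ} (B : Fin n → Fin n → ℂ) (m : ℂ) :
    (Matrix.of fun i j => B i j + m).permanent =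
      ∑ k ∈ Finset.range (n + 1), m ^ (n - k) * minorSum B k := by
  simp only [Matrix.permanent, minorSum, Matrix.of_apply, Finset.prod_add, Finset.mul_sum]
  refine Eq.trans ?_ Finset.sum_comm
  refine Finset.sum_congr rfl fun σ _ => ?_
  rw [Finset.sum_powerset, Finset.card_univ, Fintype.card_fin]
  refine Finset.sum_congr rfl fun k _ => Finset.sum_congr rfl fun S hS => ?_
  rw [Finset.prod_const, Finset.card_sdiff_of_subset (Finset.subset_univ _),
    (Finset.mem_powersetCard.1 hS).2, Finset.card_univ, Fintype.card_fin, mul_comm]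

/-- Orbit counting in a form without division: by transitivity the sum over `G` does not depend on
the base point, and summing it over all base points counts every point of `X` once for each group
element. -/
theorem card_mul_sum_smul {G X : Type*} [Group G] [Fintype G] [Fintype X] [MulAction G X]
    [MulAction.IsPretransitive G X] (F : X → ℂ) (r : X) :
    (Fintype.card X : ℂ) * ∑ g : G, F (g • r) = Fintype.card G * ∑ x, F x := by
  have h : ∀ r' : X, ∑ g : G, F (g • r') = ∑ g : G, F (g • r) := by
    intro r'
    obtain ⟨a, rfl⟩ := MulAction.exists_smul_eq G r r'
    simp only [smul_smul]
    exact Equiv.sum_comp (Equiv.mulRight a) fun g => F (g • r)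
  have h1 : ∑ r' : X, ∑ g : G, F (g • r') = Fintype.card X * ∑ g : G, F (g • r) := by
    simp [h]
  have h2 : ∀ g : G, ∑ r' : X, F (g • r') = ∑ x, F x := fun g =>
    Equiv.sum_comp (MulAction.toPerm g) F
  rw [← h1, Finset.sum_comm]
  simp [h2]

/-- Embeddings with image `S` are the orderings of `S`, that is, bijections from `Fin k` to `S`. -/
theorem card_embedding_map_eq {n k : ℕ} {S : Finset (Fin n)} (hS : S.card = k) :
    ((Finset.univ : Finset (Fin k ↪ Fin n)).filter fun r => Finset.univ.map r = S).card =
      k.factorial := by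
  have e : (Fin k ≃ S) ≃ {r : Fin k ↪ Fin n // Finset.univ.map r = S} :=
    { toFun := fun f => ⟨f.toEmbedding.trans (Function.Embedding.subtype _), by
        ext i
        simp only [Finset.mem_map, Finset.mem_univ, true_and]
        constructor
        · rintro ⟨b, rfl⟩; exact (f b).2
        · intro hi; exact ⟨f.symm ⟨i, hi⟩, by simp⟩⟩
      invFun := fun r => Equiv.ofBijective
        (fun b => ⟨r.1 b, r.2.subset (Finset.mem_map_of_mem r.1 (Finset.mem_univ b))⟩)
        ⟨fun a b h => r.1.injective (by simpa using h), fun ⟨i, hi⟩ => by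
          obtain ⟨b, -, hb⟩ := Finset.mem_map.1 (r.2.symm.subset hi)
          exact ⟨b, by simpa using hb⟩⟩
      left_inv := fun f => by ext b; rfl
      right_inv := fun r => by ext b; rfl }
  rw [← Fintype.card_subtype, ← Fintype.card_congr e,
    Fintype.card_equiv (Fintype.equivOfCardEq (by simp [hS])), Fintype.card_fin]

theorem sum_embedding_prod {n : ℕ} (k : ℕ) (f : Fin n → ℂ) :
    ∑ r : Fin k ↪ Fin n, ∏ b, f (r b) =
      k.factorial * ∑ S ∈ Finset.powersetCard k Finset.univ, ∏ i ∈ S, f i := by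
  have h : ∀ r : Fin k ↪ Fin n, ∏ b, f (r b) = ∏ i ∈ Finset.univ.map r, f i := fun r => by
    rw [Finset.prod_map]
  rw [Finset.mul_sum, ← Finset.sum_fiberwise_of_maps_to (s := Finset.univ)
    (t := Finset.powersetCard k Finset.univ) (g := fun r : Fin k ↪ Fin n => Finset.univ.map r)
    (fun r _ => by simp [Finset.mem_powersetCard])]
  refine Finset.sum_congr rfl fun S hS => ?_
  rw [Finset.sum_congr rfl (g := fun _ => ∏ i ∈ S, f i) fun r hr => by
    rw [h, (Finset.mem_filter.1 hr).2]]
  rw [Finset.sum_const, card_embedding_map_eq (Finset.mem_powersetCard.1 hS).2, nsmul_eq_mul]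

open Classical in
/-- The sum of `∏ b, B (p b).1 (p b).2` over sequences of `k` cells in different rows and
columns. -/
noncomputable def rookSum {n : ℕ} (B : Fin n → Fin n → ℂ) (k : ℕ) : ℂ :=
  ∑ p : Fin k → Fin n × Fin n,
    if Function.Injective (fun b => (p b).1) ∧ Function.Injective (fun b => (p b).2)
    then ∏ b, B (p b).1 (p b).2 else 0

theorem rookSum_eq {n : ℕ} (B : Fin n → Fin n → ℂ) (k : ℕ) :
    rookSum B k = ∑ r : Fin k ↪ Fin n, ∑ s : Fin k ↪ Fin n, ∏ b, B (s b) (r b) := by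
  classical
  unfold rookSum
  rw [← Fintype.sum_prod_type' (f := fun r s : Fin k ↪ Fin n => ∏ b, B (s b) (r b))]
  symm
  refine Fintype.sum_of_injective (fun q : (Fin k ↪ Fin n) × (Fin k ↪ Fin n) =>
    fun b => (q.2 b, q.1 b)) ?_ _ _ ?_ ?_
  · rintro ⟨r, s⟩ ⟨r', s'⟩ h
    have := fun b => congrFun h b
    simp only [Prod.mk.injEq] at this ⊢
    exact ⟨DFunLike.ext _ _ fun b => (this b).2, DFunLike.ext _ _ fun b => (this b).1⟩
  · intro p hp
    rw [if_neg]
    rintro ⟨h1, h2⟩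
    exact hp ⟨(⟨_, h2⟩, ⟨_, h1⟩), rfl⟩
  · rintro ⟨r, s⟩
    rw [if_pos ⟨s.injective, r.injective⟩]

/-- The symmetric group acts transitively on embeddings of `Fin k`. Hence, for a fixed sequence of
columns, the average over all sequences of distinct rows equals the average over permutations
applied to the columns. Forgetting the order of the columns gives the factor `k!`. -/
theorem factorial_mul_rookSum {n : ℕ} (B : Fin n → Fin n → ℂ) (k : ℕ) :
    (n.factorial : ℂ) * rookSum B k = n.descFactorial k * k.factorial * minorSum B k := by
  have h : ∀ r : Fin k ↪ Fin n, (n.factorial : ℂ) * ∑ s : Fin k ↪ Fin n, ∏ b, B (s b) (r b) =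
      n.descFactorial k * ∑ σ : Equiv.Perm (Fin n), ∏ b, B (σ (r b)) (r b) := by
    intro r
    have : MulAction.IsPretransitive (Equiv.Perm (Fin n)) (Fin k ↪ Fin n) :=
      (Equiv.Perm.isMultiplyPretransitive (Fin n) k)
    have := card_mul_sum_smul (G := Equiv.Perm (Fin n)) (fun s : Fin k ↪ Fin n => ∏ b, B (s b) (r b)) r
    rw [Fintype.card_embedding_eq, Fintype.card_perm, Fintype.card_fin, Fintype.card_fin] at this
    exact this.symm
  rw [rookSum_eq, Finset.mul_sum, Finset.sum_congr rfl fun r _ => h r, ← Finset.mul_sum,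
    Finset.sum_comm, minorSum, mul_assoc, Finset.mul_sum (a := (k.factorial : ℂ))]
  congr 1
  exact Finset.sum_congr rfl fun σ _ => sum_embedding_prod k fun i => B (σ i) i

/-! ### The value computed by the program -/

/-- Cell 0 holds the mean, so the digit zero contributes mean minus mean. Only words without zero
digits up to their leading digit survive, and these encode sequences of matrix cells. -/
theorem wordFactor_eq_zero_of_digit {n w b : ℕ} (x : ℕ → ℂ)
    (h : wordDigit (n * n + 1) w b = 0) : wordFactor n x w b = 0 := by
  simp [wordFactor, h]

/-- Words are grouped by their number `k` of digits. On the right, a word shorter than `k` has a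
padding zero digit and drops out. -/
theorem sum_wordProd (n : ℕ) (x : ℕ → ℂ) (t : ℕ) :
    ∑ w ∈ Finset.range ((n * n + 1) ^ t), wordProd n x w t =
      ∑ k ∈ Finset.range (t + 1), ∑ w ∈ Finset.range ((n * n + 1) ^ k),
        ∏ b ∈ Finset.range k, wordFactor n x w b := by
  induction t with
  | zero => simp [wordProd]
  | succ t ih =>
    have hle : (n * n + 1) ^ t ≤ (n * n + 1) ^ (t + 1) :=
      Nat.pow_le_pow_right (Nat.succ_pos _) (Nat.le_succ t)
    rw [Finset.sum_range_succ _ (t + 1), ← ih, ← Finset.sum_range_add_sum_Ico _ hle,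
      ← Finset.sum_range_add_sum_Ico (fun w => ∏ b ∈ Finset.range (t + 1), wordFactor n x w b) hle]
    have h1 : ∀ w ∈ Finset.range ((n * n + 1) ^ t),
        wordProd n x w (t + 1) = wordProd n x w t := fun w hw =>
      (wordProd_eq_of_le x (Nat.le_succ t) (Nat.div_eq_of_lt (Finset.mem_range.1 hw))).symm
    have h2 : ∀ w ∈ Finset.range ((n * n + 1) ^ t),
        ∏ b ∈ Finset.range (t + 1), wordFactor n x w b = 0 := fun w hw =>
      Finset.prod_eq_zero (Finset.mem_range.2 (Nat.lt_succ_self t))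
        (wordFactor_eq_zero_of_digit x
          (by simp [wordDigit, Nat.div_eq_of_lt (Finset.mem_range.1 hw)]))
    have h3 : ∀ w ∈ Finset.Ico ((n * n + 1) ^ t) ((n * n + 1) ^ (t + 1)),
        wordProd n x w (t + 1) = ∏ b ∈ Finset.range (t + 1), wordFactor n x w b := by
      intro w hw
      refine Finset.prod_congr rfl fun b hb => if_neg ?_
      have hb' : (n * n + 1) ^ b ≤ w := (Nat.pow_le_pow_right (Nat.succ_pos _)
        (Nat.lt_succ_iff.1 (Finset.mem_range.1 hb))).trans (Finset.mem_Ico.1 hw).1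
      exact (Nat.div_pos hb' (by positivity)).ne'
    rw [Finset.sum_congr rfl h1, Finset.sum_congr rfl h2, Finset.sum_congr rfl h3,
      Finset.sum_const_zero, zero_add]

theorem wordDigit_finFunctionFinEquiv {M k : ℕ} (c : Fin k → Fin M) (b : Fin k) :
    wordDigit M (finFunctionFinEquiv c) b = c b := by
  rw [wordDigit, ← finFunctionFinEquiv_symm_apply_val, Equiv.symm_apply_apply]

/-- The index of a cell of the matrix in the memory of the machine. -/
def cellIndex {n : ℕ} (p : Fin n × Fin n) : Fin (n * n + 1) := (finProdFinEquiv p).succ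

theorem cellRow_cellIndex {n : ℕ} (p : Fin n × Fin n) : cellRow n (cellIndex p) = p.1 := by
  have h : 0 < n := p.1.pos
  simp [cellRow, cellIndex, Nat.add_mul_div_left _ _ h, Nat.div_eq_of_lt p.2.2]

theorem cellCol_cellIndex {n : ℕ} (p : Fin n × Fin n) : cellCol n (cellIndex p) = p.2 := by
  simp [cellCol, cellIndex, Nat.mod_eq_of_lt p.2.2]

theorem cellIndex_injective {n : ℕ} : Function.Injective (cellIndex (n := n)) :=
  (Fin.succ_injective _).comp finProdFinEquiv.injective

theorem inputState_num_cellIndex {n : ℕ} (m : ℂ) (A : Fin n → Fin n → ℂ) (p : Fin n × Fin n) :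
    (inputState n m A).num (cellIndex p) = A p.1 p.2 := by
  have h : ((cellIndex p : Fin (n * n + 1)) : ℕ) - 1 = finProdFinEquiv p := by simp [cellIndex]
  have h0 : ((cellIndex p : Fin (n * n + 1)) : ℕ) ≠ 0 := by simp [cellIndex]
  simp only [inputState, h0, if_false, h, (finProdFinEquiv p).2, dif_pos, Fin.eta,
    Equiv.symm_apply_apply]

theorem exists_eq_of_not_injective {k : ℕ} {α : Type*} {f : Fin k → α}
    (h : ¬ Function.Injective f) : ∃ b c : Fin k, c < b ∧ f c = f b := by
  simp only [Function.Injective, not_forall] at h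
  obtain ⟨a, b, hab, hne⟩ := h
  rcases lt_or_gt_of_ne hne with h | h
  exacts [⟨b, a, h, hab⟩, ⟨a, b, h, hab.symm⟩]

theorem prod_wordFactor_cellIndex {n k : ℕ} (m : ℂ) (A : Fin n → Fin n → ℂ)
    (p : Fin k → Fin n × Fin n) [Decidable (Function.Injective (fun b => (p b).1) ∧
      Function.Injective (fun b => (p b).2))] :
    ∏ b ∈ Finset.range k, wordFactor n (inputState n m A).num
      (finFunctionFinEquiv fun b => cellIndex (p b)) b =
    (if Function.Injective (fun b => (p b).1) ∧ Function.Injective (fun b => (p b).2)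
      then ∏ b, (A (p b).1 (p b).2 - m) else 0) /
      (m ^ k * (n.descFactorial k * k.factorial : ℕ)) := by
  classical
  have hm : (inputState n m A).num 0 = m := by simp [inputState]
  have hd : ∀ b : Fin k, wordDigit (n * n + 1) (finFunctionFinEquiv fun b => cellIndex (p b)) b =
      cellIndex (p b) := fun b => wordDigit_finFunctionFinEquiv _ b
  have hex : ∀ b : Fin k, (∃ c < (b : ℕ),
      cellRow n (wordDigit (n * n + 1) (finFunctionFinEquiv fun b => cellIndex (p b)) c) =
        cellRow n (wordDigit (n * n + 1) (finFunctionFinEquiv fun b => cellIndex (p b)) b) ∨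
      cellCol n (wordDigit (n * n + 1) (finFunctionFinEquiv fun b => cellIndex (p b)) c) =
        cellCol n (wordDigit (n * n + 1) (finFunctionFinEquiv fun b => cellIndex (p b)) b)) ↔
      ∃ c < b, (p c).1 = (p b).1 ∨ (p c).2 = (p b).2 := by
    intro b
    constructor
    · rintro ⟨c, hc, h⟩
      have hd' := hd ⟨c, hc.trans b.2⟩
      dsimp only at hd'
      rw [hd b, hd', cellRow_cellIndex, cellRow_cellIndex, cellCol_cellIndex,
        cellCol_cellIndex] at h
      exact ⟨⟨c, hc.trans b.2⟩, hc, h.imp Fin.ext Fin.ext⟩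
    · rintro ⟨c, hc, h⟩
      refine ⟨c, hc, ?_⟩
      rw [hd b, hd c, cellRow_cellIndex, cellRow_cellIndex, cellCol_cellIndex, cellCol_cellIndex]
      exact h.imp (congrArg _) (congrArg _)
  have hfac : ∀ b : Fin k, wordFactor n (inputState n m A).num
      (finFunctionFinEquiv fun b => cellIndex (p b)) b =
      (A (p b).1 (p b).2 - m) *
        (if ∃ c < b, (p c).1 = (p b).1 ∨ (p c).2 = (p b).2 then 0 else 1) /
        (m * (((n - b) * (b + 1) : ℕ) : ℂ)) := by
    intro b
    unfold wordFactor
    simp only [hex b]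
    rw [hd b, inputState_num_cellIndex, hm]
  -- The factors `n - b` build the falling factorial and the factors `b + 1` build `k!`.
  have hden : ∏ b : Fin k, (m * (((n - b) * (b + 1) : ℕ) : ℂ)) =
      m ^ k * (n.descFactorial k * k.factorial : ℕ) := by
    rw [Finset.prod_mul_distrib, Finset.prod_const, Finset.card_univ, Fintype.card_fin,
      Nat.descFactorial_eq_prod_range, ← Finset.prod_range_add_one_eq_factorial,
      ← Finset.prod_mul_distrib, Nat.cast_prod,
      Finset.prod_range fun i => (((n - i) * (i + 1) : ℕ) : ℂ)]
  rw [Finset.prod_range, Finset.prod_congr rfl fun b _ => hfac b, Finset.prod_div_distrib, hden,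
    Finset.prod_mul_distrib]
  congr 1
  split_ifs with h
  · rw [Finset.prod_congr rfl (g := fun _ => (1 : ℂ)) (s₁ := Finset.univ) (fun b _ => if_neg ?_)]
    · simp
    · rintro ⟨c, hc, h1 | h1⟩
      exacts [hc.ne (h.1 h1), hc.ne (h.2 h1)]
  · rw [not_and_or] at h
    obtain ⟨b, hb⟩ : ∃ b, ∃ c < b, (p c).1 = (p b).1 ∨ (p c).2 = (p b).2 := by
      rcases h with h | h
      · obtain ⟨b, c, hc, h1⟩ := exists_eq_of_not_injective h
        exact ⟨b, c, hc, .inl h1⟩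
      · obtain ⟨b, c, hc, h1⟩ := exists_eq_of_not_injective h
        exact ⟨b, c, hc, .inr h1⟩
    exact mul_eq_zero_of_right _ (Finset.prod_eq_zero (Finset.mem_univ b) (if_pos hb))

theorem sum_words_eq {n : ℕ} (m : ℂ) (A : Fin n → Fin n → ℂ) (k : ℕ) :
    ∑ w ∈ Finset.range ((n * n + 1) ^ k),
      ∏ b ∈ Finset.range k, wordFactor n (inputState n m A).num w b =
    minorSum (fun i j => A i j - m) k / (m ^ k * n.factorial) := by
  classical
  have h1 : ∑ w ∈ Finset.range ((n * n + 1) ^ k),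
      ∏ b ∈ Finset.range k, wordFactor n (inputState n m A).num w b =
      rookSum (fun i j => A i j - m) k / (m ^ k * (n.descFactorial k * k.factorial : ℕ)) := by
    rw [Finset.sum_range, ← finFunctionFinEquiv.sum_comp, rookSum, Finset.sum_div]
    symm
    refine Fintype.sum_of_injective (fun p b => cellIndex (p b))
      (fun p q h => funext fun b => cellIndex_injective (congrFun h b)) _ _ ?_ ?_
    · intro c hc
      have : ∃ b, c b = 0 := by
        by_contra! h
        refine hc ⟨fun b => finProdFinEquiv.symm ((c b).pred (h b)), funext fun b => ?_⟩
        show (finProdFinEquiv (finProdFinEquiv.symm ((c b).pred (h b)))).succ = c b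
        rw [Equiv.apply_symm_apply, Fin.succ_pred]
      obtain ⟨b, hb⟩ := this
      refine Finset.prod_eq_zero (Finset.mem_range.2 b.2) (wordFactor_eq_zero_of_digit _ ?_)
      rw [wordDigit_finFunctionFinEquiv, hb]
      rfl
    · intro p
      rw [prod_wordFactor_cellIndex]
  rw [h1]
  have h2 := factorial_mul_rookSum (fun i j => A i j - m) k
  -- In the degenerate cases both sides are zero: for `k > n` there are no `k` distinct columns and
  -- the left denominator vanishes, and for `m ^ k = 0` both denominators vanish.
  by_cases hk : n < k
  · have : minorSum (fun i j => A i j - m) k = 0 := by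
      unfold minorSum
      rw [Finset.powersetCard_eq_empty.2 (by simpa using hk)]
      simp
    simp [this, Nat.descFactorial_of_lt hk]
  by_cases hm : m ^ k = 0
  · simp [hm]
  have hn0 : (n.factorial : ℂ) ≠ 0 := by exact_mod_cast n.factorial_ne_zero
  have hk0 : (k.factorial : ℂ) ≠ 0 := by exact_mod_cast k.factorial_ne_zero
  have hd0 : (n.descFactorial k : ℂ) ≠ 0 := by
    exact_mod_cast (Nat.descFactorial_eq_zero_iff_lt.not.2 hk)
  push_cast
  rw [div_eq_div_iff (by positivity) (by positivity)]
  linear_combination m ^ k * h2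

/-- The Taylor sum of degree `t` (in `z`) of the normalized permanent of `J + z B`. -/
noncomputable def taylorSum {n : ℕ} (B : Fin n → Fin n → ℂ) (t : ℕ) (z : ℂ) : ℂ :=
  ∑ k ∈ Finset.range (t + 1), z ^ k * (minorSum B k / n.factorial)

theorem permanent_eq_taylorSum {n : ℕ} (A : Fin n → Fin n → ℂ) {m : ℂ} (hm : m ≠ 0) :
    (Matrix.of A).permanent = taylorSum (fun i j => A i j - m) n m⁻¹ * (m ^ n * n.factorial) := by
  have h := permanent_add_const (fun i j => A i j - m) m
  simp only [sub_add_cancel] at h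
  rw [h, taylorSum, Finset.sum_mul]
  refine Finset.sum_congr rfl fun k hk => ?_
  have hn0 : (n.factorial : ℂ) ≠ 0 := by exact_mod_cast n.factorial_ne_zero
  rw [← pow_sub_mul_pow m (Nat.lt_succ_iff.1 (Finset.mem_range.1 hk)), inv_pow]
  field_simp

theorem permanentProgram_output (n : ℕ) (m : ℂ) (A : Fin n → Fin n → ℂ) :
    ∃ s t, Exec permanentProgram (inputState n m A) s t ∧
      s.num 0 = taylorSum (fun i j => A i j - m) (Nat.size n) m⁻¹ * (m ^ n * n.factorial) := by
  obtain ⟨s, t, h1, -, h2⟩ := permanentProgram_halts n _ (inputState_num_last n m A)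
  refine ⟨s, t, h1, ?_⟩
  have hm : (inputState n m A).num 0 = m := by simp [inputState]
  rw [h2, sum_wordProd, hm, taylorSum]
  congr 1
  refine Finset.sum_congr rfl fun k _ => ?_
  rw [sum_words_eq, inv_pow]
  field_simp

/-- A relative error bound from an absolute one. -/
theorem approxPermanent_of_taylorSum {n : ℕ} {m : ℂ} (hm : m ≠ 0) {A : Fin n → Fin n → ℂ} {η κ : ℝ}
    (hη : 0 < η) (hκ : 0 ≤ κ) (hκ1 : κ ≤ 1)
    (h1 : η ≤ ‖taylorSum (fun i j => A i j - m) (Nat.size n) m⁻¹‖)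
    (h2 : ‖taylorSum (fun i j => A i j - m) n m⁻¹ -
      taylorSum (fun i j => A i j - m) (Nat.size n) m⁻¹‖ ≤ η * κ / 2) :
    ApproxPermanent permanentProgram κ n m A := by
  obtain ⟨s, t, hs, hout⟩ := permanentProgram_output n m A
  set f := taylorSum (fun i j => A i j - m) n m⁻¹ with hf
  set g := taylorSum (fun i j => A i j - m) (Nat.size n) m⁻¹ with hg
  -- Since `κ ≤ 1`, the error `η κ / 2` is at most half of the lower bound for `g`. The relative
  -- error is then at most `(η κ / 2) / (η / 2) = κ`.
  have h3 : η / 2 ≤ ‖f‖ := by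
    have := norm_sub_norm_le g f
    rw [norm_sub_rev] at this
    nlinarith
  have hf0 : f ≠ 0 := fun h => by rw [h, norm_zero] at h3; linarith
  refine ⟨s, t, g / f - 1, hs, ?_, ?_⟩
  · rw [hout, permanent_eq_taylorSum A hm, ← hf]
    field_simp
    ring
  · rw [div_sub_one hf0, norm_div, norm_sub_rev, div_le_iff₀ (by linarith)]
    nlinarith

/-! ### Second moment of the Taylor remainder -/

/-- The product of the entries of `B` in the cells of `P`. -/
noncomputable def cellMonomial {n : ℕ} (P : Finset (Fin n × Fin n)) (B : Fin n → Fin n → ℂ) : ℂ :=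
  ∏ i, ∏ j, if (i, j) ∈ P then B i j else 1

theorem cellMonomial_eq_prod {n : ℕ} (P : Finset (Fin n × Fin n)) (B : Fin n → Fin n → ℂ) :
    cellMonomial P B = ∏ p ∈ P, B p.1 p.2 := by
  rw [cellMonomial, ← Fintype.prod_prod_type' (f := fun i j => if (i, j) ∈ P then B i j else 1),
    Finset.prod_ite_mem, Finset.univ_inter]

/-! ### Orthogonality of the monomials in the entries -/

section Moments

variable {ν : Measure ℂ}

theorem HasMeanVariance.integral_mul_conj (h : HasMeanVariance ν 0 1) :
    ∫ x, x * (starRingEnd ℂ) x ∂ν = 1 := by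
  have h1 := h.variance
  simp only [sub_zero] at h1
  have h2 : ∀ x : ℂ, x * (starRingEnd ℂ) x = ((‖x‖ ^ 2 : ℝ) : ℂ) := fun x => by
    rw [Complex.mul_conj, Complex.normSq_eq_norm_sq]
  simp only [h2]
  rw [integral_complex_ofReal, h1]
  simp

theorem HasMeanVariance.integrable_mul_conj (h : HasMeanVariance ν 0 1) :
    Integrable (fun x => x * (starRingEnd ℂ) x) ν := by
  have h1 : Integrable (fun x : ℂ => ‖x‖ ^ 2) ν := h.memLp.integrable_norm_pow (by norm_num)
  have h2 : ∀ x : ℂ, x * (starRingEnd ℂ) x = ((‖x‖ ^ 2 : ℝ) : ℂ) := fun x => by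
    rw [Complex.mul_conj, Complex.normSq_eq_norm_sq]
  simp only [h2]
  exact h1.ofReal

theorem HasMeanVariance.integrable (h : HasMeanVariance ν 0 1) :
    Integrable (fun x : ℂ => x) ν := by
  have := h.isProbabilityMeasure
  exact h.memLp.integrable (by norm_num)

theorem HasMeanVariance.pair (h : HasMeanVariance ν 0 1) (p q : Prop) [Decidable p] [Decidable q] :
    Integrable (fun x => (if p then x else 1) * (starRingEnd ℂ) (if q then x else 1)) ν ∧
    ∫ x, (if p then x else 1) * (starRingEnd ℂ) (if q then x else 1) ∂ν =
      if p ↔ q then 1 else 0 := by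
  have := h.isProbabilityMeasure
  have hm := h.mean
  have hi := h.integrable
  by_cases hp : p <;> by_cases hq : q <;> simp only [hp, hq, if_true, if_false, iff_true, iff_false,
    not_true_eq_false, map_one, mul_one, one_mul]
  · exact ⟨h.integrable_mul_conj, h.integral_mul_conj⟩
  · exact ⟨hi, hm⟩
  · refine ⟨(Complex.conjCLE.toContinuousLinearMap.integrable_comp hi), ?_⟩
    rw [integral_conj, hm, map_zero]
  · simp

end Moments

variable {n : ℕ} {ν : Fin n → Fin n → Measure ℂ}

theorem isProbabilityMeasure_matrixLaw (h : ∀ i j, IsProbabilityMeasure (ν i j)) :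
    IsProbabilityMeasure (matrixLaw ν) := by
  unfold matrixLaw
  infer_instance

/-- The integral factors over rows and then over entries. A cell in exactly one of `P`, `Q`
contributes a mean or its conjugate, which is zero; any other cell contributes one. No moments
besides mean and variance enter. -/
theorem cellMonomial_orthogonal (h : ∀ i j, HasMeanVariance (ν i j) 0 1)
    (P Q : Finset (Fin n × Fin n)) :
    Integrable (fun B => cellMonomial P B * (starRingEnd ℂ) (cellMonomial Q B)) (matrixLaw ν) ∧
    ∫ B, cellMonomial P B * (starRingEnd ℂ) (cellMonomial Q B) ∂(matrixLaw ν) =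
      if P = Q then 1 else 0 := by
  have := fun i j => (h i j).isProbabilityMeasure
  have e : ∀ B : Fin n → Fin n → ℂ, cellMonomial P B * (starRingEnd ℂ) (cellMonomial Q B) =
      ∏ i, ∏ j, ((if (i, j) ∈ P then B i j else 1) *
        (starRingEnd ℂ) (if (i, j) ∈ Q then B i j else 1)) := fun B => by
    simp only [cellMonomial, map_prod, Finset.prod_mul_distrib]
  simp only [e, matrixLaw]
  constructor
  · refine Integrable.fintype_prod (𝕜 := ℂ) (f := fun (i : Fin n) (r : Fin n → ℂ) =>
      ∏ j, ((if (i, j) ∈ P then r j else 1) * (starRingEnd ℂ) (if (i, j) ∈ Q then r j else 1)))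
      fun i => ?_
    exact Integrable.fintype_prod (𝕜 := ℂ) (f := fun (j : Fin n) (x : ℂ) =>
      ((if (i, j) ∈ P then x else 1) * (starRingEnd ℂ) (if (i, j) ∈ Q then x else 1)))
      fun j => ((h i j).pair _ _).1
  · rw [integral_fintype_prod_eq_prod (𝕜 := ℂ) (f := fun (i : Fin n) (r : Fin n → ℂ) =>
      ∏ j, ((if (i, j) ∈ P then r j else 1) * (starRingEnd ℂ) (if (i, j) ∈ Q then r j else 1)))]
    have e2 : ∀ i, ∫ r, ∏ j, ((if (i, j) ∈ P then r j else 1) *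
        (starRingEnd ℂ) (if (i, j) ∈ Q then r j else 1)) ∂(Measure.pi fun j => ν i j) =
        ∏ j, if ((i, j) ∈ P ↔ (i, j) ∈ Q) then 1 else 0 := fun i => by
      rw [integral_fintype_prod_eq_prod (𝕜 := ℂ) (f := fun (j : Fin n) (x : ℂ) =>
        ((if (i, j) ∈ P then x else 1) * (starRingEnd ℂ) (if (i, j) ∈ Q then x else 1)))]
      exact Finset.prod_congr rfl fun j _ => ((h i j).pair _ _).2
    simp only [e2]
    split_ifs with hPQ
    · simp [hPQ]
    · obtain ⟨⟨i, j⟩, hij⟩ : ∃ p, ¬ (p ∈ P ↔ p ∈ Q) := by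
        by_contra! hc
        exact hPQ (Finset.ext hc)
      exact Finset.prod_eq_zero (Finset.mem_univ i)
        (Finset.prod_eq_zero (Finset.mem_univ j) (if_neg hij))

/-- Different indices may give the same monomial. As `c` depends only on the monomial, each index
pairs with all indices of its fiber, whence the cardinality. -/
theorem second_moment (h : ∀ i j, HasMeanVariance (ν i j) 0 1) {ι : Type*} (I : Finset ι)
    (P : ι → Finset (Fin n × Fin n)) (c : ι → ℂ) (hc : ∀ α β, P α = P β → c α = c β) :
    Integrable (fun B => ‖∑ α ∈ I, c α * cellMonomial (P α) B‖ ^ 2) (matrixLaw ν) ∧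
    ∫ B, ‖∑ α ∈ I, c α * cellMonomial (P α) B‖ ^ 2 ∂(matrixLaw ν) =
      ∑ α ∈ I, ‖c α‖ ^ 2 * (I.filter fun β => P β = P α).card := by
  have e : ∀ B : Fin n → Fin n → ℂ,
      ((‖∑ α ∈ I, c α * cellMonomial (P α) B‖ ^ 2 : ℝ) : ℂ) =
      ∑ α ∈ I, ∑ β ∈ I, c α * (starRingEnd ℂ) (c β) *
        (cellMonomial (P α) B * (starRingEnd ℂ) (cellMonomial (P β) B)) := fun B => by
    rw [← Complex.normSq_eq_norm_sq, ← Complex.mul_conj, map_sum, Finset.sum_mul_sum]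
    refine Finset.sum_congr rfl fun α _ => Finset.sum_congr rfl fun β _ => ?_
    rw [map_mul]; ring
  have hint : Integrable (fun B => ((‖∑ α ∈ I, c α * cellMonomial (P α) B‖ ^ 2 : ℝ) : ℂ))
      (matrixLaw ν) := by
    simp only [e]
    exact integrable_finsetSum _ fun α _ => integrable_finsetSum _ fun β _ =>
      (cellMonomial_orthogonal h _ _).1.const_mul _
  refine ⟨hint.re, ?_⟩
  have : ((∫ B, ‖∑ α ∈ I, c α * cellMonomial (P α) B‖ ^ 2 ∂(matrixLaw ν) : ℝ) : ℂ) =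
      ((∑ α ∈ I, ‖c α‖ ^ 2 * (I.filter fun β => P β = P α).card : ℝ) : ℂ) := by
    rw [← integral_complex_ofReal]
    simp only [e]
    rw [integral_finsetSum _ fun α _ => integrable_finsetSum _ fun β _ =>
      (cellMonomial_orthogonal h _ _).1.const_mul _]
    push_cast
    refine Finset.sum_congr rfl fun α _ => ?_
    rw [integral_finsetSum _ fun β _ => (cellMonomial_orthogonal h _ _).1.const_mul _,
      Finset.card_filter, Nat.cast_sum, Finset.mul_sum]
    refine Finset.sum_congr rfl fun β _ => ?_
    rw [integral_const_mul, (cellMonomial_orthogonal h _ _).2]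
    by_cases hab : P β = P α
    · rw [if_pos hab, if_pos hab.symm, hc _ _ hab, Complex.mul_conj, Complex.normSq_eq_norm_sq]
      simp
    · rw [if_neg hab, if_neg (Ne.symm hab)]
      simp
  exact_mod_cast this

/-! ### Counting repeated monomials in the Taylor remainder -/

/-- The cells `(σ j, j)` with `j ∈ S`. -/
def permCells (q : Equiv.Perm (Fin n) × Finset (Fin n)) : Finset (Fin n × Fin n) :=
  q.2.map ⟨fun j => (q.1 j, j), fun _ _ h => (Prod.mk.inj h).2⟩

theorem cellMonomial_permCells (q : Equiv.Perm (Fin n) × Finset (Fin n)) (B : Fin n → Fin n → ℂ) :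
    cellMonomial (permCells q) B = ∏ j ∈ q.2, B (q.1 j) j := by
  rw [cellMonomial_eq_prod, permCells, Finset.prod_map]
  rfl

theorem mem_permCells {q : Equiv.Perm (Fin n) × Finset (Fin n)} {i j : Fin n} :
    (i, j) ∈ permCells q ↔ j ∈ q.2 ∧ q.1 j = i := by
  simp only [permCells, Finset.mem_map]
  constructor
  · rintro ⟨a, ha, h⟩
    obtain ⟨h1, rfl⟩ := Prod.mk.inj h
    exact ⟨ha, h1⟩
  · rintro ⟨h1, h2⟩
    exact ⟨j, h1, Prod.ext h2 rfl⟩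

theorem permCells_eq_iff (q q' : Equiv.Perm (Fin n) × Finset (Fin n)) :
    permCells q' = permCells q ↔ q'.2 = q.2 ∧ ∀ j ∈ q.2, q'.1 j = q.1 j := by
  constructor
  · intro h
    have hmem : ∀ i j, (i, j) ∈ permCells q' ↔ (i, j) ∈ permCells q := fun i j => by rw [h]
    simp only [mem_permCells] at hmem
    have h2 : ∀ j ∈ q.2, j ∈ q'.2 ∧ q'.1 j = q.1 j := fun j hj =>
      (hmem (q.1 j) j).2 ⟨hj, rfl⟩
    refine ⟨Finset.ext fun j => ⟨fun hj => ((hmem (q'.1 j) j).1 ⟨hj, rfl⟩).1,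
      fun hj => (h2 j hj).1⟩, fun j hj => (h2 j hj).2⟩
  · rintro ⟨h1, h2⟩
    ext ⟨i, j⟩
    rw [mem_permCells, mem_permCells, h1]
    exact and_congr_right fun hj => by rw [h2 j hj]

/-- Orbit counting on embeddings of `S`, applied to the indicator of the restriction of `σ`:
prescribing `|S|` values of a permutation leaves `(n - |S|)!` choices. -/
theorem card_perm_agree (σ : Equiv.Perm (Fin n)) (S : Finset (Fin n)) :
    (n.descFactorial S.card : ℂ) *
      ((Finset.univ : Finset (Equiv.Perm (Fin n))).filter fun τ => ∀ j ∈ S, τ j = σ j).card =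
      n.factorial := by
  classical
  have : MulAction.IsPretransitive (Equiv.Perm (Fin n)) (Fin S.card ↪ Fin n) :=
    Equiv.Perm.isMultiplyPretransitive (Fin n) S.card
  let r : Fin S.card ↪ Fin n := S.equivFin.symm.toEmbedding.trans (Function.Embedding.subtype _)
  have h := card_mul_sum_smul (G := Equiv.Perm (Fin n))
    (fun x : Fin S.card ↪ Fin n => if x = σ • r then (1 : ℂ) else 0) r
  rw [Fintype.card_embedding_eq, Fintype.card_perm, Fintype.card_fin, Fintype.card_fin,
    Finset.sum_ite_eq' , if_pos (Finset.mem_univ _), mul_one] at h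
  rw [← h, Finset.card_filter, Nat.cast_sum]
  congr 1
  refine Finset.sum_congr rfl fun τ _ => ?_
  rw [Nat.cast_ite, Nat.cast_one, Nat.cast_zero]
  refine if_congr ⟨fun hj => DFunLike.ext _ _ fun b => hj _ (S.equivFin.symm b).2,
    fun hr j hj => ?_⟩ rfl rfl
  have := DFunLike.congr_fun hr (S.equivFin ⟨j, hj⟩)
  simpa [r, Function.Embedding.smul_apply] using this

/-- The pairs of a permutation and a set of more than `t` columns. -/
def largeTerms (n t : ℕ) : Finset (Equiv.Perm (Fin n) × Finset (Fin n)) :=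
  Finset.univ ×ˢ (Finset.univ.filter fun S => t < S.card)

theorem sum_filter_card {M : Type*} [AddCommMonoid M] (t : ℕ) (f : Finset (Fin n) → M) :
    ∑ S with t < S.card, f S =
      ∑ k ∈ Finset.Ioc t n, ∑ S ∈ Finset.powersetCard k Finset.univ, f S := by
  rw [← Finset.sum_fiberwise_of_maps_to (t := Finset.Ioc t n) (g := Finset.card)
    (fun S hS => Finset.mem_Ioc.2 ⟨(Finset.mem_filter.1 hS).2, by simpa using S.card_le_univ⟩)]
  refine Finset.sum_congr rfl fun k hk => Finset.sum_congr ?_ fun _ _ => rfl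
  ext S
  simp only [Finset.mem_filter, Finset.mem_univ, true_and, Finset.mem_powersetCard,
    Finset.subset_univ]
  exact ⟨fun h => h.2, fun h => ⟨h ▸ (Finset.mem_Ioc.1 hk).1, h⟩⟩

theorem taylorSum_sub (B : Fin n → Fin n → ℂ) {t : ℕ} (ht : t ≤ n) (z : ℂ) :
    taylorSum B n z - taylorSum B t z =
      ∑ q ∈ largeTerms n t, z ^ q.2.card / n.factorial * cellMonomial (permCells q) B := by
  have h1 : taylorSum B n z - taylorSum B t z =
      ∑ k ∈ Finset.Ioc t n, z ^ k * (minorSum B k / n.factorial) := by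
    rw [taylorSum, taylorSum, sub_eq_iff_eq_add', ← Finset.sum_range_add_sum_Ico _
      (Nat.succ_le_succ ht)]
    congr 1
    exact Finset.sum_congr (by ext k; simp only [Finset.mem_Ico, Finset.mem_Ioc]; omega)
      fun _ _ => rfl
  rw [h1, largeTerms, Finset.sum_product]
  simp only [cellMonomial_permCells, sum_filter_card]
  rw [Finset.sum_comm]
  refine Finset.sum_congr rfl fun k _ => ?_
  rw [minorSum, Finset.sum_div, Finset.mul_sum]
  refine Finset.sum_congr rfl fun σ _ => ?_
  rw [Finset.sum_div, Finset.mul_sum]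
  refine Finset.sum_congr rfl fun S hS => ?_
  rw [(Finset.mem_powersetCard.1 hS).2]
  ring

theorem card_largeTerms_fiber {t : ℕ} {q : Equiv.Perm (Fin n) × Finset (Fin n)}
    (hq : q ∈ largeTerms n t) :
    (((largeTerms n t).filter fun q' => permCells q' = permCells q).card : ℝ) =
      n.factorial / n.descFactorial q.2.card := by
  have h1 : ((largeTerms n t).filter fun q' => permCells q' = permCells q).card =
      ((Finset.univ : Finset (Equiv.Perm (Fin n))).filter fun τ => ∀ j ∈ q.2, τ j = q.1 j).card := by
    refine Finset.card_bij' (fun q' _ => q'.1) (fun τ _ => (τ, q.2)) ?_ ?_ ?_ ?_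
    · intro q' hq'
      simpa using ((permCells_eq_iff q q').1 (Finset.mem_filter.1 hq').2).2
    · intro τ hτ
      refine Finset.mem_filter.2 ⟨?_, (permCells_eq_iff q _).2 ⟨rfl, (Finset.mem_filter.1 hτ).2⟩⟩
      exact Finset.mem_product.2 ⟨Finset.mem_univ _, (Finset.mem_product.1 hq).2⟩
    · intro q' hq'
      exact Prod.ext rfl ((permCells_eq_iff q q').1 (Finset.mem_filter.1 hq').2).1.symm
    · intro τ _
      rfl
  have h2 : (n.descFactorial q.2.card : ℝ) * ((Finset.univ : Finset (Equiv.Perm (Fin n))).filter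
      fun τ => ∀ j ∈ q.2, τ j = q.1 j).card = n.factorial := by
    exact_mod_cast card_perm_agree q.1 q.2
  have h3 : (n.descFactorial q.2.card : ℝ) ≠ 0 := by
    have : ¬ n < q.2.card := by simpa using q.2.card_le_univ
    exact_mod_cast (Nat.descFactorial_eq_zero_iff_lt.not.2 this)
  rw [h1, eq_div_iff h3, ← h2, mul_comm]

/-- Degree `k` has `n! · choose n k` indices, each with squared coefficient `|z|^(2k)/n!²` and fiber
size `n!/descFactorial n k`. The product is `|z|^(2k)/k!`. -/
theorem taylorRemainder_second_moment (h : ∀ i j, HasMeanVariance (ν i j) 0 1) {t : ℕ}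
    (ht : t ≤ n) (z : ℂ) :
    Integrable (fun B => ‖taylorSum B n z - taylorSum B t z‖ ^ 2) (matrixLaw ν) ∧
    ∫ B, ‖taylorSum B n z - taylorSum B t z‖ ^ 2 ∂(matrixLaw ν) =
      ∑ k ∈ Finset.Ioc t n, (‖z‖ ^ 2) ^ k / k.factorial := by
  simp only [taylorSum_sub _ ht]
  obtain ⟨h1, h2⟩ := second_moment h (largeTerms n t) permCells
    (fun q => z ^ q.2.card / (n.factorial : ℂ))
    (fun q q' hqq => by rw [((permCells_eq_iff q' q).1 hqq).1])
  refine ⟨h1, h2.trans ?_⟩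
  have hn0 : (n.factorial : ℝ) ≠ 0 := by exact_mod_cast n.factorial_ne_zero
  rw [Finset.sum_congr rfl (g := fun q => (‖z‖ ^ 2) ^ q.2.card /
    (n.factorial * n.descFactorial q.2.card)) fun q hq => ?_]
  · rw [largeTerms, Finset.sum_product]
    simp only [sum_filter_card, Finset.sum_const, Finset.card_univ, Fintype.card_perm,
      Fintype.card_fin]
    rw [nsmul_eq_mul, Finset.mul_sum]
    refine Finset.sum_congr rfl fun k hk => ?_
    rw [Finset.sum_congr rfl (g := fun _ => (‖z‖ ^ 2) ^ k / (n.factorial * n.descFactorial k))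
      fun S hS => by rw [(Finset.mem_powersetCard.1 hS).2], Finset.sum_const,
      Finset.card_powersetCard, Finset.card_univ, Fintype.card_fin, nsmul_eq_mul,
      Nat.descFactorial_eq_factorial_mul_choose]
    have hc : (n.choose k : ℝ) ≠ 0 := by
      exact_mod_cast (Nat.choose_pos (Finset.mem_Ioc.1 hk).2).ne'
    have hk0 : (k.factorial : ℝ) ≠ 0 := by exact_mod_cast k.factorial_ne_zero
    push_cast
    field_simp
  · rw [card_largeTerms_fiber hq, norm_div, norm_pow, Complex.norm_natCast, div_pow, ← pow_mul,
      ← pow_mul, mul_comm 2]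
    field_simp

/-! ### The tail probability of the Taylor remainder -/

theorem sum_pow_div_factorial_le {R : ℝ} (hR : 0 ≤ R) (t n : ℕ) :
    ∑ k ∈ Finset.Ioc t n, R ^ k / k.factorial ≤ R ^ t / t.factorial * Real.exp R := by
  have h1 : ∑ k ∈ Finset.Ioc t n, R ^ k / k.factorial ≤
      ∑ k ∈ Finset.Ico t (n + 1), R ^ k / k.factorial := by
    refine Finset.sum_le_sum_of_subset_of_nonneg (fun k hk => ?_) fun k _ _ => by positivity
    simp only [Finset.mem_Ioc, Finset.mem_Ico] at hk ⊢
    omega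
  refine h1.trans ?_
  rw [Finset.sum_Ico_eq_sum_range]
  refine le_trans (Finset.sum_le_sum (g := fun j => R ^ t / t.factorial * (R ^ j / j.factorial))
    fun j _ => ?_) ?_
  · rw [pow_add, div_mul_div_comm]
    gcongr
    exact_mod_cast Nat.le_of_dvd (Nat.factorial_pos _)
      (Nat.factorial_mul_factorial_dvd_factorial_add t j)
  · rw [← Finset.mul_sum]
    gcongr
    exact Real.sum_le_exp_of_nonneg hR _

theorem measurable_taylorSum (t : ℕ) (z : ℂ) :
    Measurable fun B : Fin n → Fin n → ℂ => taylorSum B t z := by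
  unfold taylorSum minorSum
  fun_prop

/-- Markov's inequality for the squared norm, with the exponential tail bound for its mean. -/
theorem taylorRemainder_tail (h : ∀ i j, HasMeanVariance (ν i j) 0 1) {t : ℕ}
    (ht : t ≤ n) {z : ℂ} {R T : ℝ} (hz : ‖z‖ ≤ R) (hT : 0 < T) :
    matrixLaw ν {B | T < ‖taylorSum B n z - taylorSum B t z‖} ≤
      ENNReal.ofReal ((R ^ 2) ^ t / t.factorial * Real.exp (R ^ 2) / T ^ 2) := by
  have := isProbabilityMeasure_matrixLaw fun i j => (h i j).isProbabilityMeasure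
  obtain ⟨h1, h2⟩ := taylorRemainder_second_moment h ht z
  have h3 := mul_meas_ge_le_integral_of_nonneg (Filter.Eventually.of_forall fun B => by positivity)
    h1 (T ^ 2)
  rw [h2] at h3
  have hz2 : ‖z‖ ^ 2 ≤ R ^ 2 := by gcongr
  have h4 : ∑ k ∈ Finset.Ioc t n, (‖z‖ ^ 2) ^ k / k.factorial ≤
      (R ^ 2) ^ t / t.factorial * Real.exp (R ^ 2) :=
    (sum_pow_div_factorial_le (by positivity) t n).trans (by gcongr)
  refine (measure_mono (t := {B | T ^ 2 ≤ ‖taylorSum B n z - taylorSum B t z‖ ^ 2})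
    fun B hB => pow_le_pow_left₀ hT.le (le_of_lt hB) 2).trans ?_
  rw [← ofReal_measureReal]
  refine ENNReal.ofReal_le_ofReal ?_
  rw [le_div_iff₀ (by positivity), mul_comm]
  exact h3.trans h4

/-! ### A polynomial with value one at the origin is rarely small -/

/-- The largest of several distinct positive integers is at least their number; induct by adding
maxima. -/
theorem factorial_card_le_prod (T : Finset ℕ) (hT : ∀ x ∈ T, 0 < x) :
    T.card.factorial ≤ ∏ x ∈ T, x := by
  induction T using Finset.induction_on_max with
  | empty => simp
  | insert a T ha ih =>
    have haT : a ∉ T := fun h => lt_irrefl a (ha a h)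
    rw [Finset.card_insert_of_notMem haT, Finset.prod_insert haT, Nat.factorial_succ]
    refine Nat.mul_le_mul ?_ (ih fun x hx => hT x (Finset.mem_insert_of_mem hx))
    have hsub : insert a T ⊆ Finset.Icc 1 a := by
      intro x hx
      refine Finset.mem_Icc.2 ⟨hT x hx, ?_⟩
      rcases Finset.mem_insert.1 hx with rfl | h
      exacts [le_rfl, (ha x h).le]
    simpa [Finset.card_insert_of_notMem haT] using Finset.card_le_card hsub

/-- With `a` elements of `S` below `i` and `b` above it, the distances on the two sides multiply to
at least `a! b!`, which is `t!` divided by a binomial coefficient at most `2 ^ t`. -/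
theorem factorial_le_two_pow_mul_prod_dist {t : ℕ} {S : Finset ℕ} {i : ℕ} (hi : i ∈ S)
    (hS : S.card = t + 1) : t.factorial ≤ 2 ^ t * ∏ j ∈ S.erase i, Nat.dist i j := by
  set A := (S.erase i).filter fun j => j < i with hA
  set B := (S.erase i).filter fun j => ¬ j < i with hB
  have hcard : A.card + B.card = t := by
    rw [Finset.card_filter_add_card_filter_not, Finset.card_erase_of_mem hi, hS]
    rfl
  have h1 : A.card.factorial ≤ ∏ j ∈ A, Nat.dist i j := by
    have hinj : Set.InjOn (Nat.dist i) A := by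
      intro x hx y hy hxy
      have hx := (Finset.mem_filter.1 hx).2
      have hy := (Finset.mem_filter.1 hy).2
      simp only [Nat.dist] at hxy
      omega
    rw [← Finset.card_image_of_injOn hinj, ← Finset.prod_image (f := fun x => x) hinj]
    refine factorial_card_le_prod _ fun x hx => ?_
    obtain ⟨j, hj, rfl⟩ := Finset.mem_image.1 hx
    exact Nat.dist_pos_of_ne (Finset.mem_filter.1 hj).2.ne'
  have h2 : B.card.factorial ≤ ∏ j ∈ B, Nat.dist i j := by
    have hinj : Set.InjOn (Nat.dist i) B := by
      intro x hx y hy hxy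
      have hx := (Finset.mem_filter.1 hx).2
      have hy := (Finset.mem_filter.1 hy).2
      simp only [Nat.dist] at hxy
      omega
    rw [← Finset.card_image_of_injOn hinj, ← Finset.prod_image (f := fun x => x) hinj]
    refine factorial_card_le_prod _ fun x hx => ?_
    obtain ⟨j, hj, rfl⟩ := Finset.mem_image.1 hx
    exact Nat.dist_pos_of_ne (Finset.ne_of_mem_erase (Finset.mem_filter.1 hj).1).symm
  rw [← Finset.prod_filter_mul_prod_filter_not (S.erase i) (fun j => j < i)]
  calc t.factorial = t.choose A.card * A.card.factorial * B.card.factorial := by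
        rw [← hcard, mul_assoc, ← Nat.choose_mul_factorial_mul_factorial (Nat.le_add_right A.card B.card),
          Nat.add_sub_cancel_left, mul_assoc]
    _ ≤ 2 ^ t * (∏ j ∈ A, Nat.dist i j) * ∏ j ∈ B, Nat.dist i j := by
        gcongr
        exact Nat.choose_le_two_pow _ _
    _ = _ := mul_assoc _ _ _

/-- `z 0, …, z (N - 1)` are points of the disc of radius `r` whose mutual distances are at least
`r ℓ |i - j| / N`. -/
structure Separated (r ℓ : ℝ) (N : ℕ) (z : ℕ → ℂ) : Prop where
  norm_le : ∀ j < N, ‖z j‖ ≤ r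
  dist_le : ∀ i < N, ∀ j < N, r * (ℓ / N) * |(i : ℝ) - j| ≤ ‖z i - z j‖

open Polynomial in
-- Suppose `t + 1` of the points give values below `η`, and interpolate `f` there. At the origin a
-- basis polynomial is a product of `|z j| / |z i - z j| ≤ (N/ℓ) / |i - j|`, hence at most `(2N/ℓ) ^
-- t / t!`. Then `1 = |f(0)| < η (t + 1) (2N/ℓ) ^ t / t! ≤ 1`, a contradiction.
theorem card_small_values_le {r ℓ η : ℝ} {N t : ℕ} {z : ℕ → ℂ} (hr : 0 < r) (hℓ : 0 < ℓ)
    (hz : Separated r ℓ N z) (f : ℂ[X]) (hf : f.natDegree ≤ t) (hf0 : f.eval 0 = 1)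
    (hη : η * ((t + 1) * (2 * (N / ℓ)) ^ t) ≤ t.factorial) :
    ((Finset.range N).filter fun j => ‖f.eval (z j)‖ < η).card ≤ t := by
  by_contra! hcon
  obtain ⟨S, hS, hcard⟩ := Finset.exists_subset_card_eq (Nat.succ_le_of_lt hcon)
  rw [Nat.succ_eq_add_one] at hcard
  have hSN : ∀ j ∈ S, j < N := fun j hj => Finset.mem_range.1 (Finset.mem_filter.1 (hS hj)).1
  have hSη : ∀ j ∈ S, ‖f.eval (z j)‖ < η := fun j hj => (Finset.mem_filter.1 (hS hj)).2
  have hne : S.Nonempty := Finset.card_pos.1 (by omega)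
  have hN : (0 : ℝ) < N := by
    obtain ⟨j, hj⟩ := hne
    exact_mod_cast (Nat.zero_le j).trans_lt (hSN j hj)
  have hη0 : 0 < η := by
    obtain ⟨j, hj⟩ := hne
    exact (norm_nonneg _).trans_lt (hSη j hj)
  have hdist : ∀ i ∈ S, ∀ j ∈ S.erase i,
      0 < r * (ℓ / N) * (Nat.dist i j : ℝ) ∧ r * (ℓ / N) * (Nat.dist i j : ℝ) ≤ ‖z i - z j‖ := by
    intro i hi j hj
    have e : ((Nat.dist i j : ℕ) : ℝ) = |(i : ℝ) - j| := by
      rcases le_total i j with h | h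
      · rw [Nat.dist_eq_sub_of_le h, Nat.cast_sub h, abs_sub_comm, abs_of_nonneg]
        exact sub_nonneg.2 (by exact_mod_cast h)
      · rw [Nat.dist_eq_sub_of_le_right h, Nat.cast_sub h, abs_of_nonneg]
        exact sub_nonneg.2 (by exact_mod_cast h)
    have hpos : 0 < Nat.dist i j := Nat.dist_pos_of_ne (Finset.ne_of_mem_erase hj).symm
    refine ⟨by positivity, ?_⟩
    rw [e]
    exact hz.dist_le i (hSN i hi) j (hSN j (Finset.mem_of_mem_erase hj))
  have hinj : Set.InjOn z S := by
    intro i hi j hj hij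
    by_contra hne
    have := hdist i hi j (Finset.mem_erase.2 ⟨Ne.symm hne, hj⟩)
    rw [hij, sub_self, norm_zero] at this
    linarith [this.1, this.2]
  have hdeg : f.degree < S.card := by
    rw [hcard]
    exact (degree_le_of_natDegree_le hf).trans_lt (by exact_mod_cast Nat.lt_succ_self t)
  have hL := congrArg (eval 0) (Lagrange.eq_interpolate hinj hdeg)
  rw [hf0, Lagrange.interpolate_apply, eval_finsetSum] at hL
  have hbasis : ∀ i ∈ S, ‖eval 0 (Lagrange.basis S z i)‖ ≤ (2 * (N / ℓ)) ^ t / t.factorial := by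
    intro i hi
    have h1 : ‖eval 0 (Lagrange.basis S z i)‖ ≤
        ∏ j ∈ S.erase i, (N / ℓ) * (Nat.dist i j : ℝ)⁻¹ := by
      rw [Lagrange.basis, eval_prod, norm_prod]
      refine Finset.prod_le_prod (fun _ _ => norm_nonneg _) fun j hj => ?_
      obtain ⟨h1, h2⟩ := hdist i hi j hj
      have hpos : (0 : ℝ) < Nat.dist i j := by
        exact_mod_cast Nat.dist_pos_of_ne (Finset.ne_of_mem_erase hj).symm
      rw [Lagrange.basisDivisor, eval_mul, eval_C, eval_sub, eval_X, eval_C, zero_sub, norm_mul,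
        norm_neg, norm_inv]
      calc ‖z i - z j‖⁻¹ * ‖z j‖ ≤ (r * (ℓ / N) * (Nat.dist i j : ℝ))⁻¹ * r := by
            gcongr
            exact hz.norm_le j (hSN j (Finset.mem_of_mem_erase hj))
        _ = (N / ℓ) * (Nat.dist i j : ℝ)⁻¹ := by field_simp
    refine h1.trans ?_
    rw [Finset.prod_mul_distrib, Finset.prod_const, Finset.card_erase_of_mem hi, hcard,
      Nat.add_sub_cancel, Finset.prod_inv_distrib, mul_pow]
    have h2 : (t.factorial : ℝ) ≤ 2 ^ t * ∏ j ∈ S.erase i, (Nat.dist i j : ℝ) := by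
      exact_mod_cast factorial_le_two_pow_mul_prod_dist hi hcard
    have h3 : (0 : ℝ) < ∏ j ∈ S.erase i, (Nat.dist i j : ℝ) :=
      Finset.prod_pos fun j hj => by
        exact_mod_cast Nat.dist_pos_of_ne (Finset.ne_of_mem_erase hj).symm
    have h4 : (0 : ℝ) < t.factorial := by exact_mod_cast t.factorial_pos
    rw [le_div_iff₀ h4, ← div_eq_mul_inv, div_mul_eq_mul_div, div_le_iff₀ h3]
    have h5 : 0 ≤ (N / ℓ) ^ t := by positivity
    nlinarith [mul_le_mul_of_nonneg_left h2 h5]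
  have h4 : (0 : ℝ) < t.factorial := by exact_mod_cast t.factorial_pos
  have hK : 0 < (2 * (N / ℓ)) ^ t / (t.factorial : ℝ) := by positivity
  have : (1 : ℝ) < 1 := by
    calc (1 : ℝ) = ‖∑ i ∈ S, eval 0 (C (eval (z i) f) * Lagrange.basis S z i)‖ := by
          rw [← hL, norm_one]
      _ ≤ ∑ i ∈ S, ‖eval 0 (C (eval (z i) f) * Lagrange.basis S z i)‖ := norm_sum_le _ _
      _ < ∑ i ∈ S, η * ((2 * (N / ℓ)) ^ t / t.factorial) := by
          refine Finset.sum_lt_sum_of_nonempty hne fun i hi => ?_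
          rw [eval_mul, eval_C, norm_mul]
          calc _ ≤ ‖eval (z i) f‖ * ((2 * (N / ℓ)) ^ t / t.factorial) :=
                mul_le_mul_of_nonneg_left (hbasis i hi) (norm_nonneg _)
            _ < _ := mul_lt_mul_of_pos_right (hSη i hi) hK
      _ = η * ((t + 1) * (2 * (N / ℓ)) ^ t) / t.factorial := by
          rw [Finset.sum_const, hcard, nsmul_eq_mul]
          push_cast
          ring
      _ ≤ 1 := (div_le_one h4).2 hη
  exact lt_irrefl _ this

open Polynomial in
theorem card_small_taylorSum_le {n : ℕ} {r ℓ η : ℝ} {N t : ℕ} {z : ℕ → ℂ} (hr : 0 < r) (hℓ : 0 < ℓ)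
    (hz : Separated r ℓ N z) (B : Fin n → Fin n → ℂ)
    (hη : η * ((t + 1) * (2 * (N / ℓ)) ^ t) ≤ t.factorial) :
    ((Finset.range N).filter fun j => ‖taylorSum B t (z j)‖ < η).card ≤ t := by
  set f : ℂ[X] := ∑ k ∈ Finset.range (t + 1), C (minorSum B k / n.factorial) * X ^ k with hf
  have he : ∀ x, f.eval x = taylorSum B t x := fun x => by
    simp only [hf, taylorSum, eval_finsetSum, eval_mul, eval_C, eval_pow, eval_X, mul_comm]
  have hdeg : f.natDegree ≤ t := by
    refine natDegree_sum_le_of_forall_le _ _ fun k hk => ?_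
    exact (natDegree_C_mul_X_pow_le _ _).trans (Nat.lt_succ_iff.1 (Finset.mem_range.1 hk))
  have h0 : f.eval 0 = 1 := by
    rw [he, taylorSum, Finset.sum_range_succ']
    have : (n.factorial : ℂ) ≠ 0 := by exact_mod_cast n.factorial_ne_zero
    simp [minorSum, Fintype.card_perm, this]
  have := card_small_values_le hr hℓ hz f hdeg h0 hη
  simpa only [he] using this

/-! ### The scales -/

noncomputable def logLog (n : ℕ) : ℝ := Real.log (Real.log n)

/-- The lower bound for the truncated Taylor sum. -/
noncomputable def sizeThreshold (n : ℕ) : ℝ :=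
  1 / ((Nat.size n + 1) * (6 * (⌈logLog n⌉₊ * logLog n)) ^ Nat.size n)

/-- The number of candidate points. -/
noncomputable def numPoints (n : ℕ) : ℕ := Nat.size n * ⌈logLog n⌉₊

/-- A bound for the probability that the Taylor remainder is large. -/
noncomputable def tailBound (c n : ℕ) : ℝ :=
  (logLog n ^ 2) ^ Nat.size n / (Nat.size n).factorial * Real.exp (logLog n ^ 2) /
    (sizeThreshold n * (1 / (n : ℝ) ^ c) / 2) ^ 2

/-- One term of the series of `exp t`, together with `e < 3`. -/
theorem pow_self_le_factorial_mul (t : ℕ) : (t : ℝ) ^ t ≤ t.factorial * 3 ^ t := by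
  have h := Real.pow_div_factorial_le_exp (x := (t : ℝ)) (Nat.cast_nonneg t) t
  have h3 : Real.exp t ≤ 3 ^ t := by
    rw [← Real.exp_one_pow]
    exact pow_le_pow_left₀ (Real.exp_pos 1).le (Real.exp_one_lt_d9.le.trans (by norm_num)) t
  rw [div_le_iff₀ (by exact_mod_cast t.factorial_pos)] at h
  nlinarith [mul_le_mul_of_nonneg_right h3 (Nat.cast_nonneg (α := ℝ) t.factorial)]

theorem sizeThreshold_pos {n : ℕ} (hn : 0 < logLog n) : 0 < sizeThreshold n := by
  have : (0 : ℝ) < ⌈logLog n⌉₊ := by exact_mod_cast Nat.ceil_pos.2 hn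
  unfold sizeThreshold
  positivity

/-- The constant 6 in `sizeThreshold` is the 2 of the interpolation bound times the 3 of `t! ≥ (t/3)
^ t`. -/
theorem sizeThreshold_mul_le {n : ℕ} (hn : 0 < logLog n) :
    sizeThreshold n * ((Nat.size n + 1) * (2 * (numPoints n / (1 / logLog n))) ^ Nat.size n) ≤
      (Nat.size n).factorial := by
  have hρ : (0 : ℝ) < ⌈logLog n⌉₊ := by exact_mod_cast Nat.ceil_pos.2 hn
  unfold sizeThreshold numPoints
  push_cast
  set t := Nat.size n
  have h := pow_self_le_factorial_mul t
  rw [div_div_eq_mul_div, div_one, one_div_mul_eq_div, mul_div_mul_left _ _ (by positivity),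
    ← div_pow]
  have e : 2 * ((t : ℝ) * ⌈logLog n⌉₊ * logLog n) / (6 * (⌈logLog n⌉₊ * logLog n)) = t / 3 := by
    field_simp
    ring
  rw [e, div_pow, div_le_iff₀ (by positivity)]
  exact h

/-- Apart from the leading 4, each factor is at most a `t`-th power: `n ^ (2c) ≤ (4 ^ c) ^ t` as `n
≤ 2 ^ t`, and `1/t! ≤ (3/t) ^ t`. The combined base is `4 ^ c · 1296 · y ^ 6 / t`, and `h3` makes it
at most `1/2`. -/
theorem tailBound_le {c n : ℕ} {y : ℝ} (hn : 0 < logLog n) (hy : 1 ≤ y) (h1 : logLog n ≤ y)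
    (h2 : (⌈logLog n⌉₊ : ℝ) ≤ y) (h3 : 2 * (4 ^ c * 1296) * y ^ 6 ≤ Nat.size n) :
    tailBound c n ≤ 4 * (1 / 2) ^ Nat.size n := by
  have hρ : (0 : ℝ) < ⌈logLog n⌉₊ := by exact_mod_cast Nat.ceil_pos.2 hn
  have hn0 : (0 : ℝ) < n := by
    rcases Nat.eq_zero_or_pos n with rfl | h
    · simp [logLog] at hn
    · exact_mod_cast h
  unfold tailBound sizeThreshold
  obtain ⟨R, hR⟩ : ∃ R, R = logLog n := ⟨_, rfl⟩
  obtain ⟨ρ, hρ'⟩ : ∃ ρ : ℝ, ρ = ⌈logLog n⌉₊ := ⟨_, rfl⟩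
  obtain ⟨t, ht⟩ : ∃ t, t = Nat.size n := ⟨_, rfl⟩
  rw [← hρ', ← hR, ← ht]
  rw [← hρ'] at hρ h2
  rw [← hR] at hn h1
  rw [← ht] at h3
  have hc1 : (1 : ℝ) ≤ 4 ^ c := one_le_pow₀ (by norm_num)
  have hy6 : (1 : ℝ) ≤ y ^ 6 := one_le_pow₀ hy
  have ht0 : (0 : ℝ) < t := by nlinarith [mul_le_mul hc1 hy6 (by norm_num) (by positivity)]
  have hnt : (n : ℝ) ≤ 2 ^ t := by exact_mod_cast ht ▸ (Nat.lt_size_self n).le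
  have e0 : (R ^ 2) ^ t / t.factorial * Real.exp (R ^ 2) /
      (1 / ((t + 1) * (6 * (ρ * R)) ^ t) * (1 / (n : ℝ) ^ c) / 2) ^ 2 =
      4 * ((n ^ c) ^ 2 * (t + 1) ^ 2 * ((36 * (ρ * R) ^ 2 * R ^ 2) ^ t) * Real.exp (R ^ 2) *
        (1 / t.factorial)) := by
    have : (36 * (ρ * R) ^ 2 * R ^ 2) ^ t = (R ^ 2) ^ t * ((6 * (ρ * R)) ^ t) ^ 2 := by
      rw [← pow_mul (6 * (ρ * R)), mul_comm t 2, pow_mul (6 * (ρ * R)), ← mul_pow]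
      ring
    rw [this]
    field_simp
    norm_num
  rw [e0]
  have b1 : ((n : ℝ) ^ c) ^ 2 ≤ (4 ^ c) ^ t := by
    calc ((n : ℝ) ^ c) ^ 2 ≤ ((2 ^ t) ^ c) ^ 2 := by gcongr
      _ = (4 ^ c) ^ t := by
        rw [show (4 : ℝ) = 2 ^ 2 by norm_num, ← pow_mul, ← pow_mul, ← pow_mul, ← pow_mul]
        congr 1; ring
  have b2 : ((t : ℝ) + 1) ^ 2 ≤ 4 ^ t := by
    have : (t : ℝ) + 1 ≤ 2 ^ t := by exact_mod_cast Nat.lt_two_pow_self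
    calc ((t : ℝ) + 1) ^ 2 ≤ (2 ^ t) ^ 2 := by gcongr
      _ = 4 ^ t := by rw [← pow_mul, mul_comm, pow_mul]; norm_num
  have b3 : (36 * (ρ * R) ^ 2 * R ^ 2) ^ t ≤ (36 * y ^ 6) ^ t := by
    refine pow_le_pow_left₀ (by positivity) ?_ t
    calc 36 * (ρ * R) ^ 2 * R ^ 2 ≤ 36 * (y * y) ^ 2 * y ^ 2 := by gcongr
      _ = 36 * y ^ 6 := by ring
  have b4 : Real.exp (R ^ 2) ≤ 3 ^ t := by
    have h : R ^ 2 ≤ t := by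
      calc R ^ 2 ≤ y ^ 2 := by gcongr
        _ ≤ y ^ 6 := pow_le_pow_right₀ hy (by norm_num)
        _ ≤ t := by nlinarith [mul_le_mul_of_nonneg_right hc1 (zero_le_one.trans hy6)]
    refine (Real.exp_le_exp.2 h).trans ?_
    rw [← Real.exp_one_pow]
    exact pow_le_pow_left₀ (Real.exp_pos 1).le (Real.exp_one_lt_d9.le.trans (by norm_num)) t
  have b5 : 1 / (t.factorial : ℝ) ≤ (3 / t) ^ t := by
    have := pow_self_le_factorial_mul t
    have hf : (0 : ℝ) < t.factorial := by exact_mod_cast t.factorial_pos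
    rw [div_pow, div_le_div_iff₀ hf (by positivity)]
    linarith
  have b6 : (4 ^ c) * 4 * (36 * y ^ 6) * 3 * (3 / t) ≤ 1 / 2 := by
    have : (4 ^ c) * 4 * (36 * y ^ 6) * 3 * (3 / t) = (4 ^ c * 1296) * y ^ 6 / t := by ring
    rw [this, div_le_iff₀ ht0]
    linarith
  calc 4 * (((n : ℝ) ^ c) ^ 2 * (t + 1) ^ 2 * ((36 * (ρ * R) ^ 2 * R ^ 2) ^ t) * Real.exp (R ^ 2) *
        (1 / t.factorial))
      ≤ 4 * ((4 ^ c) ^ t * 4 ^ t * (36 * y ^ 6) ^ t * 3 ^ t * (3 / t) ^ t) := by gcongr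
    _ = 4 * ((4 ^ c) * 4 * (36 * y ^ 6) * 3 * (3 / t)) ^ t := by
        rw [← mul_pow, ← mul_pow, ← mul_pow, ← mul_pow]
    _ ≤ 4 * (1 / 2) ^ t := by gcongr

theorem tendsto_size : Tendsto Nat.size atTop atTop := by
  refine tendsto_atTop.2 fun b => ?_
  filter_upwards [eventually_ge_atTop (2 ^ b)] with n hn
  exact (Nat.lt_size.2 hn).le

theorem tendsto_logLog : Tendsto logLog atTop atTop :=
  Real.tendsto_log_atTop.comp (Real.tendsto_log_atTop.comp tendsto_natCast_atTop_atTop)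

theorem logLog_le_log_size {n : ℕ} (hn : 0 < logLog n) : logLog n ≤ Real.log (Nat.size n) := by
  have hlog : 0 < Real.log n := by
    by_contra h
    have h2 : (0 : ℝ) ≤ Real.log n := Real.log_natCast_nonneg n
    have : Real.log n = 0 := le_antisymm (not_lt.1 h) h2
    simp [logLog, this] at hn
  have hn0 : (0 : ℝ) < n := by
    rcases Nat.eq_zero_or_pos n with rfl | h
    · simp at hlog
    · exact_mod_cast h
  refine Real.log_le_log hlog ?_
  have hnt : (n : ℝ) ≤ 2 ^ Nat.size n := by exact_mod_cast (Nat.lt_size_self n).le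
  calc Real.log n ≤ Real.log (2 ^ Nat.size n) := Real.log_le_log hn0 hnt
    _ = Nat.size n * Real.log 2 := Real.log_pow _ _
    _ ≤ Nat.size n * 1 := by
        gcongr
        exact Real.log_two_lt_d9.le.trans (by norm_num)
    _ = Nat.size n := mul_one _

theorem eventually_log_pow_le (K : ℝ) :
    ∀ᶠ x : ℝ in atTop, K * (Real.log x + 1) ^ 6 ≤ x := by
  -- Evaluating at `e x` turns `log x + 1` into a single logarithm.
  have h1 : Tendsto (fun x : ℝ => Real.exp 1 * x) atTop atTop :=
    tendsto_id.const_mul_atTop (Real.exp_pos 1)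
  have h2 : (fun x : ℝ => Real.log x ^ 6) =o[atTop] fun x => x := Real.isLittleO_pow_log_id_atTop
  have h3 := h1.eventually (h2.bound (c := 1 / ((|K| + 1) * Real.exp 1)) (by positivity))
  filter_upwards [h3, eventually_gt_atTop 0] with x hx hx0
  rw [Real.log_mul (Real.exp_pos 1).ne' hx0.ne', Real.log_exp, norm_pow, Real.norm_eq_abs,
    Real.norm_eq_abs, abs_of_pos (mul_pos (Real.exp_pos 1) hx0)] at hx
  have e : 1 / ((|K| + 1) * Real.exp 1) * (Real.exp 1 * x) = x / (|K| + 1) := by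
    have := Real.exp_pos 1
    field_simp
  rw [e, add_comm 1, Even.pow_abs (by decide), le_div_iff₀ (by positivity)] at hx
  have h6 : 0 ≤ (Real.log x + 1) ^ 6 := by positivity
  nlinarith [le_abs_self K]

theorem tendsto_tailBound (c : ℕ) : Tendsto (tailBound c) atTop (𝓝 0) := by
  have h0 : Tendsto (fun n => 4 * (1 / 2 : ℝ) ^ Nat.size n) atTop (𝓝 0) := by
    have := ((tendsto_pow_atTop_nhds_zero_of_lt_one (r := (1 / 2 : ℝ)) (by norm_num)
      (by norm_num)).comp tendsto_size).const_mul 4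
    simpa using this
  have hev := (tendsto_natCast_atTop_atTop.comp tendsto_size).eventually
    (eventually_log_pow_le (2 * (4 ^ c * 1296)))
  refine tendsto_of_tendsto_of_tendsto_of_le_of_le' tendsto_const_nhds h0
    (Eventually.of_forall fun n => ?_) ?_
  · unfold tailBound
    positivity
  · filter_upwards [hev, tendsto_logLog.eventually_gt_atTop 0] with n h1 h2
    have h3 := logLog_le_log_size h2
    -- The summand 1 absorbs the rounding in `⌈logLog n⌉₊`.
    refine tailBound_le h2 (y := Real.log (Nat.size n) + 1) ?_ ?_ ?_ h1
    · linarith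
    · linarith
    · exact (Nat.ceil_lt_add_one h2.le).le.trans (by linarith)

/-- The bound for the probability of failure. -/
noncomputable def failureBound (c n : ℕ) : ENNReal :=
  ENNReal.ofReal (1 / ⌈logLog n⌉₊) + ENNReal.ofReal (tailBound c n)

theorem tendsto_failureBound (c : ℕ) : Tendsto (failureBound c) atTop (𝓝 0) := by
  have h1 : Tendsto (fun n => 1 / (⌈logLog n⌉₊ : ℝ)) atTop (𝓝 0) :=
    tendsto_one_div_atTop_nhds_zero_nat.comp (tendsto_nat_ceil_atTop.comp tendsto_logLog)
  have := (ENNReal.tendsto_ofReal h1).add (ENNReal.tendsto_ofReal (tendsto_tailBound c))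
  rw [ENNReal.ofReal_zero, add_zero] at this
  exact this

/-! ### Good matrices -/

/-- The program is accurate on `m J + B` if `z = m⁻¹` and `B` is good. -/
def IsGood (c n : ℕ) (z : ℂ) (B : Fin n → Fin n → ℂ) : Prop :=
  sizeThreshold n ≤ ‖taylorSum B (Nat.size n) z‖ ∧
  ‖taylorSum B n z - taylorSum B (Nat.size n) z‖ ≤ sizeThreshold n * (1 / (n : ℝ) ^ c) / 2

theorem measurableSet_isGood (c n : ℕ) (z : ℂ) : MeasurableSet {B | IsGood c n z B} := by
  have h1 := measurable_taylorSum (n := n) (Nat.size n) z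
  have h2 := measurable_taylorSum (n := n) n z
  exact (measurableSet_le measurable_const h1.norm).inter
    (measurableSet_le (h2.sub h1).norm measurable_const)

theorem measure_not_isGood_le {c n : ℕ} {ν : Fin n → Fin n → Measure ℂ}
    (h : ∀ i j, HasMeanVariance (ν i j) 0 1) (hn : 0 < logLog n) {z : ℂ} (hz : ‖z‖ ≤ logLog n)
    (hsmall : matrixLaw ν {B | ‖taylorSum B (Nat.size n) z‖ < sizeThreshold n} ≤
      ENNReal.ofReal (1 / ⌈logLog n⌉₊)) :
    matrixLaw ν {B | ¬ IsGood c n z B} ≤ failureBound c n := by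
  have hn0 : (0 : ℝ) < n := by
    rcases Nat.eq_zero_or_pos n with rfl | h
    · simp [logLog] at hn
    · exact_mod_cast h
  have hT : 0 < sizeThreshold n * (1 / (n : ℝ) ^ c) / 2 := by
    have := sizeThreshold_pos hn
    positivity
  have hsub : {B : Fin n → Fin n → ℂ | ¬ IsGood c n z B} ⊆
      {B | ‖taylorSum B (Nat.size n) z‖ < sizeThreshold n} ∪
      {B | sizeThreshold n * (1 / (n : ℝ) ^ c) / 2 <
        ‖taylorSum B n z - taylorSum B (Nat.size n) z‖} := by
    intro B hB
    simp only [IsGood, not_and_or, not_le, Set.mem_ofPred_eq] at hB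
    exact hB
  exact (measure_mono hsub).trans ((measure_union_le _ _).trans
    (add_le_add hsmall (taylorRemainder_tail h (size_le_self n) hz hT)))

/-- The failure probabilities of the points add up to the expected number of bad points, which is at
most `t` because this holds for every `B`. Among `t ⌈logLog n⌉₊` points, some point is therefore bad
with probability at most the average. -/
theorem exists_candidate {n : ℕ} {ν : Fin n → Fin n → Measure ℂ}
    (h : ∀ i j, HasMeanVariance (ν i j) 0 1) (hn : 0 < logLog n) {r : ℝ} (hr : 0 < r) {z : ℕ → ℂ}
    (hz : Separated r (1 / logLog n) (numPoints n) z) :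
    ∃ j < numPoints n, matrixLaw ν {B | ‖taylorSum B (Nat.size n) (z j)‖ < sizeThreshold n} ≤
      ENNReal.ofReal (1 / ⌈logLog n⌉₊) := by
  classical
  have := isProbabilityMeasure_matrixLaw fun i j => (h i j).isProbabilityMeasure
  have hρ : 0 < ⌈logLog n⌉₊ := Nat.ceil_pos.2 hn
  have hn0 : 0 < n := by
    rcases Nat.eq_zero_or_pos n with rfl | h
    · simp [logLog] at hn
    · exact h
  have ht : 0 < Nat.size n := Nat.size_pos.2 hn0
  have hN : 0 < numPoints n := Nat.mul_pos ht hρ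
  have hmeas : ∀ j, MeasurableSet {B : Fin n → Fin n → ℂ |
      ‖taylorSum B (Nat.size n) (z j)‖ < sizeThreshold n} := fun j =>
    measurableSet_lt (measurable_taylorSum _ _).norm measurable_const
  have hsum : ∑ j ∈ Finset.range (numPoints n),
      matrixLaw ν {B | ‖taylorSum B (Nat.size n) (z j)‖ < sizeThreshold n} ≤ Nat.size n := by
    calc _ = ∑ j ∈ Finset.range (numPoints n), ∫⁻ B, Set.indicator
          {B | ‖taylorSum B (Nat.size n) (z j)‖ < sizeThreshold n} 1 B ∂(matrixLaw ν) :=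
          Finset.sum_congr rfl fun j _ => (lintegral_indicator_one (hmeas j)).symm
      _ = ∫⁻ B, ∑ j ∈ Finset.range (numPoints n), Set.indicator
          {B | ‖taylorSum B (Nat.size n) (z j)‖ < sizeThreshold n} 1 B ∂(matrixLaw ν) :=
          (lintegral_finsetSum _ fun j _ => measurable_one.indicator (hmeas j)).symm
      _ ≤ ∫⁻ _, (Nat.size n : ENNReal) ∂(matrixLaw ν) := by
          refine lintegral_mono fun B => ?_
          have := card_small_taylorSum_le hr (one_div_pos.2 hn) hz B (sizeThreshold_mul_le hn)
          rw [Finset.card_filter] at this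
          simp only [Set.indicator_apply, Set.mem_ofPred_eq, Pi.one_apply]
          exact_mod_cast this
      _ = Nat.size n := by simp
  have hcast : (Nat.size n : ENNReal) = ∑ _j ∈ Finset.range (numPoints n),
      ENNReal.ofReal (1 / ⌈logLog n⌉₊) := by
    rw [Finset.sum_const, Finset.card_range, nsmul_eq_mul, ← ENNReal.ofReal_natCast (numPoints n),
      ← ENNReal.ofReal_mul (Nat.cast_nonneg _), numPoints, ← ENNReal.ofReal_natCast (Nat.size n)]
    congr 1
    have : (⌈logLog n⌉₊ : ℝ) ≠ 0 := by exact_mod_cast hρ.ne'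
    push_cast
    field_simp
  rw [hcast] at hsum
  by_contra! hcon
  exact absurd hsum (not_le.2 (ENNReal.sum_lt_sum_of_nonempty
    (Finset.nonempty_range_iff.2 hN.ne') fun j hj => hcon j (Finset.mem_range.1 hj)))

/-! ### Candidate points -/

theorem separated_interval {r ℓ : ℝ} (hr : 0 < r) (hℓ : 0 < ℓ) (hℓ1 : ℓ ≤ 1) (N : ℕ) :
    Separated r ℓ N fun j => ((r * (1 - ℓ * (j / N)) : ℝ) : ℂ) where
  norm_le j hj := by
    have hN : (0 : ℝ) < N := by exact_mod_cast (Nat.zero_le j).trans_lt hj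
    have hjN : (j : ℝ) / N ≤ 1 := (div_le_one hN).2 (by exact_mod_cast hj.le)
    have hj0 : 0 ≤ (j : ℝ) / N := by positivity
    rw [Complex.norm_real, Real.norm_eq_abs, abs_of_nonneg]
    · nlinarith [mul_nonneg hr.le (mul_nonneg hℓ.le hj0)]
    · refine mul_nonneg hr.le ?_
      nlinarith
  dist_le i _ j _ := by
    rw [← Complex.ofReal_sub, Complex.norm_real, Real.norm_eq_abs]
    have : r * (1 - ℓ * (i / N)) - r * (1 - ℓ * (j / N)) = -(r * (ℓ / N) * ((i : ℝ) - j)) := by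
      ring
    rw [this, abs_neg, abs_mul (r * (ℓ / N)), abs_of_nonneg (a := r * (ℓ / N)) (by positivity)]

/-- Points of the unit circle with equally spaced imaginary parts. -/
noncomputable def circlePoint (N j : ℕ) : ℂ := ⟨√(1 - (j / N : ℝ) ^ 2), j / N⟩

theorem norm_circlePoint {N j : ℕ} (hj : j < N) : ‖circlePoint N j‖ = 1 := by
  have hN : (0 : ℝ) < N := by exact_mod_cast (Nat.zero_le j).trans_lt hj
  have hjN : (j : ℝ) / N ≤ 1 := (div_le_one hN).2 (by exact_mod_cast hj.le)
  have hj0 : 0 ≤ (j : ℝ) / N := by positivity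
  have h : ‖circlePoint N j‖ ^ 2 = 1 := by
    rw [← Complex.normSq_eq_norm_sq, Complex.normSq_apply, circlePoint,
      Real.mul_self_sqrt (by nlinarith)]
    ring
  nlinarith [norm_nonneg (circlePoint N j)]

/-- Imaginary parts alone separate the points: they are spaced by `r / N`. -/
theorem separated_circle {r ℓ : ℝ} (hr : 0 < r) (hℓ1 : ℓ ≤ 1) (N : ℕ) :
    Separated r ℓ N fun j => (r : ℂ) * circlePoint N j where
  norm_le j hj := by
    rw [norm_mul, norm_circlePoint hj, Complex.norm_real, Real.norm_eq_abs, abs_of_pos hr, mul_one]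
  dist_le i _ j _ := by
    have h1 := Complex.abs_im_le_norm ((r : ℂ) * circlePoint N i - r * circlePoint N j)
    refine le_trans ?_ h1
    have : ((r : ℂ) * circlePoint N i - r * circlePoint N j).im = r * (1 / N) * ((i : ℝ) - j) := by
      simp only [Complex.sub_im, Complex.im_ofReal_mul, circlePoint]
      ring
    rw [this, abs_mul (r * (1 / N)), abs_of_nonneg (a := r * (1 / (N : ℝ))) (by positivity)]
    gcongr

/-! ### Affine images of the entries -/

theorem minorSum_smul {n : ℕ} (B : Fin n → Fin n → ℂ) (c : ℂ) (k : ℕ) :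
    minorSum (fun i j => c * B i j) k = c ^ k * minorSum B k := by
  simp only [minorSum, Finset.mul_sum]
  refine Finset.sum_congr rfl fun σ _ => Finset.sum_congr rfl fun S hS => ?_
  rw [Finset.prod_mul_distrib, Finset.prod_const, (Finset.mem_powersetCard.1 hS).2]

theorem taylorSum_smul {n : ℕ} (B : Fin n → Fin n → ℂ) (c : ℂ) (t : ℕ) (z : ℂ) :
    taylorSum (fun i j => c * B i j) t z = taylorSum B t (c * z) := by
  refine Finset.sum_congr rfl fun k _ => ?_
  rw [minorSum_smul, mul_pow]
  ring

theorem matrixLaw_map {n : ℕ} (ν : Fin n → Fin n → Measure ℂ)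
    (h : ∀ i j, IsProbabilityMeasure (ν i j)) {f : ℂ → ℂ} (hf : Measurable f) :
    matrixLaw (fun i j => (ν i j).map f) = (matrixLaw ν).map fun B i j => f (B i j) := by
  have h1 : ∀ i j, IsProbabilityMeasure ((ν i j).map f) := fun i j =>
    Measure.isProbabilityMeasure_map hf.aemeasurable
  unfold matrixLaw
  have h2 : ∀ i, (Measure.pi fun j => (ν i j).map f) =
      (Measure.pi fun j => ν i j).map fun r j => f (r j) := fun i =>
    (Measure.pi_map_pi (μ := fun j => ν i j) (f := fun _ => f) fun j => hf.aemeasurable).symm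
  simp only [h2]
  have h3 : Measurable fun (r : Fin n → ℂ) j => f (r j) :=
    measurable_pi_lambda _ fun j => hf.comp (measurable_pi_apply j)
  have : ∀ i, IsProbabilityMeasure ((Measure.pi fun j => ν i j).map fun r j => f (r j)) :=
    fun i => Measure.isProbabilityMeasure_map h3.aemeasurable
  exact (Measure.pi_map_pi (μ := fun i => Measure.pi fun j => ν i j)
    (f := fun _ (r : Fin n → ℂ) j => f (r j)) fun i => h3.aemeasurable).symm

/-- The program fails on the matrices with entries `a X + m` only if the matrix of the `X` is not
good at `a / m`. -/
theorem measure_not_approx_le {c n : ℕ} (hn : 0 < logLog n) {κ : ℝ} (hκ : 1 / (n : ℝ) ^ c ≤ κ)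
    {ν : Fin n → Fin n → Measure ℂ} (h : ∀ i j, IsProbabilityMeasure (ν i j)) (a : ℂ) {m : ℂ}
    (hm : m ≠ 0) :
    matrixLaw (fun i j => (ν i j).map fun x => a * x + m)
      {A | ¬ ApproxPermanent permanentProgram κ n m A} ≤
    matrixLaw ν {B | ¬ IsGood c n (a * m⁻¹) B} := by
  have hn1 : (1 : ℝ) ≤ n := by
    rcases Nat.eq_zero_or_pos n with rfl | h
    · simp [logLog] at hn
    · exact_mod_cast h
  have hsub : {A : Fin n → Fin n → ℂ | ¬ ApproxPermanent permanentProgram κ n m A} ⊆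
      {A | ¬ IsGood c n m⁻¹ fun i j => A i j - m} := by
    intro A hA hgood
    refine hA ?_
    obtain ⟨s, t, E, h1, h2, h3⟩ := approxPermanent_of_taylorSum hm (sizeThreshold_pos hn)
      (κ := 1 / (n : ℝ) ^ c) (by positivity)
      (by rw [div_le_one (by positivity)]; exact one_le_pow₀ hn1) hgood.1 hgood.2
    exact ⟨s, t, E, h1, h2, h3.trans hκ⟩
  have hf : Measurable fun x : ℂ => a * x + m := by fun_prop
  have hmeas : MeasurableSet {A : Fin n → Fin n → ℂ | ¬ IsGood c n m⁻¹ fun i j => A i j - m} := by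
    have h1 : Measurable fun (A : Fin n → Fin n → ℂ) i j => A i j - m := by fun_prop
    exact (h1 (measurableSet_isGood c n m⁻¹)).compl
  refine (measure_mono hsub).trans ?_
  rw [matrixLaw_map ν h hf, Measure.map_apply (by fun_prop) hmeas]
  refine measure_mono fun B hB hgood => hB ?_
  simp only [add_sub_cancel_right]
  simpa only [IsGood, taylorSum_smul] using hgood

/-! ### The complex Gaussian law -/

theorem complexGaussian_eq_shiftLaw (m : ℝ) :
    complexGaussian m = shiftLaw (complexGaussian 0) m := by
  have hf : Measurable fun p : ℝ × ℝ => (⟨p.1, p.2⟩ : ℂ) := Complex.measurableEquivRealProd.symm.measurable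
  have h1 : gaussianReal m (1 / 2) = (gaussianReal 0 (1 / 2)).map (· + m) := by
    rw [gaussianReal_map_add_const, zero_add]
  unfold complexGaussian shiftLaw
  rw [h1, Measure.map_map (by fun_prop) hf]
  have h2 : ((gaussianReal 0 (1 / 2)).map (· + m)).prod (gaussianReal 0 (1 / 2)) =
      ((gaussianReal 0 (1 / 2)).prod (gaussianReal 0 (1 / 2))).map (Prod.map (· + m) id) := by
    rw [← Measure.map_prod_map _ _ (by fun_prop) measurable_id, Measure.map_id]
  rw [h2, Measure.map_map hf (by fun_prop)]
  congr 1
  funext p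
  apply Complex.ext <;> simp

theorem complexGaussian_zero_map_mul {u : ℂ} (hu : ‖u‖ = 1) :
    (complexGaussian 0).map (fun x => u * x) = complexGaussian 0 := by
  have hf : Measurable fun p : ℝ × ℝ => (⟨p.1, p.2⟩ : ℂ) := Complex.measurableEquivRealProd.symm.measurable
  -- The minus sign matches the orientation of `ContinuousLinearMap.rotation`.
  have hrot := IsGaussian.map_rotation_eq_self (μ := gaussianReal 0 (1 / 2)) (by simp) (-u.arg)
  unfold complexGaussian
  rw [Measure.map_map (by fun_prop) hf]
  conv_rhs => rw [← hrot]
  rw [Measure.map_map hf (by fun_prop)]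
  congr 1
  funext p
  have hre : u.re = Real.cos u.arg := by rw [Complex.cos_arg (by rintro rfl; simp at hu), hu, div_one]
  have him : u.im = Real.sin u.arg := by rw [Complex.sin_arg, hu, div_one]
  apply Complex.ext <;> simp [hre, him, ContinuousLinearMap.rotation_apply] <;> ring

theorem complexGaussian_hasMeanVariance : HasMeanVariance (complexGaussian 0) 0 1 := by
  have hf : Measurable fun p : ℝ × ℝ => (⟨p.1, p.2⟩ : ℂ) :=
    Complex.measurableEquivRealProd.symm.measurable
  have hid : MemLp (fun x : ℝ => x) 2 (gaussianReal 0 (1 / 2)) := memLp_id_gaussianReal 2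
  have hsq : ∫ x, x ^ 2 ∂(gaussianReal 0 (1 / 2)) = 1 / 2 := by
    have h1 := variance_fun_id_gaussianReal (μ := 0) (v := 1 / 2)
    rw [variance_of_integral_eq_zero (by fun_prop) (by simp)] at h1
    rw [h1]
    simp
  have h1 : MemLp (fun p : ℝ × ℝ => p.1) 2
      ((gaussianReal 0 (1 / 2)).prod (gaussianReal 0 (1 / 2))) :=
    hid.comp_fst (gaussianReal 0 (1 / 2))
  have h2 : MemLp (fun p : ℝ × ℝ => p.2) 2
      ((gaussianReal 0 (1 / 2)).prod (gaussianReal 0 (1 / 2))) :=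
    hid.comp_snd (gaussianReal 0 (1 / 2))
  have e : ∀ p : ℝ × ℝ, (⟨p.1, p.2⟩ : ℂ) = (p.1 : ℂ) + (p.2 : ℂ) * Complex.I := fun p =>
    Complex.mk_eq_add_mul_I p.1 p.2
  have e2 : ∀ p : ℝ × ℝ, ‖(⟨p.1, p.2⟩ : ℂ)‖ ^ 2 = p.1 ^ 2 + p.2 ^ 2 := fun p => by
    rw [← Complex.normSq_eq_norm_sq, Complex.normSq_apply]
    ring
  unfold complexGaussian
  refine ⟨Measure.isProbabilityMeasure_map hf.aemeasurable, ?_, ?_, ?_⟩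
  · rw [memLp_map_measure_iff (by fun_prop) hf.aemeasurable]
    refine (memLp_two_iff_integrable_sq_norm hf.aestronglyMeasurable).2 ?_
    simp only [e2]
    exact h1.integrable_sq.add h2.integrable_sq
  · rw [integral_map hf.aemeasurable (by fun_prop)]
    simp only [e]
    rw [integral_add (h1.integrable (by norm_num)).ofReal
      ((h2.integrable (by norm_num)).ofReal.mul_const _), integral_mul_const,
      integral_complex_ofReal, integral_complex_ofReal, integral_fun_fst (fun x : ℝ => x),
      integral_fun_snd (fun x : ℝ => x)]
    simp
  · rw [integral_map hf.aemeasurable (by fun_prop)]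
    simp only [sub_zero, e2]
    rw [integral_add h1.integrable_sq h2.integrable_sq, integral_fun_fst (fun x : ℝ => x ^ 2),
      integral_fun_snd (fun x : ℝ => x ^ 2), hsq]
    simp
    norm_num

/-- Multiplying all entries by `u` with `|u| = 1` preserves the law and moves `taylorSum` from `z`
to `u z`. The bound at the good candidate on the circle thus transfers to the real point `r`. -/
theorem gaussian_not_isGood_le {c n : ℕ} (hn : 1 ≤ logLog n) {r : ℝ} (hr : 0 < r)
    (hrn : r ≤ logLog n) :
    matrixLaw (fun _ _ : Fin n => complexGaussian 0) {B | ¬ IsGood c n r B} ≤ failureBound c n := by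
  have hG := complexGaussian_hasMeanVariance
  have hn0 : 0 < logLog n := by linarith
  refine measure_not_isGood_le (fun _ _ => hG) hn0
    (by rwa [Complex.norm_real, Real.norm_eq_abs, abs_of_pos hr]) ?_
  obtain ⟨j, hj, hle⟩ := exists_candidate (fun _ _ : Fin n => hG) hn0 hr
    (separated_circle hr ((div_le_one hn0).2 hn) (numPoints n))
  refine le_trans (le_of_eq ?_) hle
  have hmap := matrixLaw_map (fun _ _ : Fin n => complexGaussian 0) (fun _ _ => hG.1)
    (f := fun x => circlePoint (numPoints n) j * x) (by fun_prop)
  simp only [complexGaussian_zero_map_mul (norm_circlePoint hj)] at hmap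
  conv_lhs => rw [hmap]
  rw [Measure.map_apply (by fun_prop)
    (measurableSet_lt (measurable_taylorSum _ _).norm measurable_const)]
  congr 1
  ext B
  simp only [Set.mem_preimage, Set.mem_ofPred_eq, taylorSum_smul,
    mul_comm (circlePoint _ _) (r : ℂ)]

theorem shiftLaw_eq (ν : Measure ℂ) (m : ℝ) :
    shiftLaw ν m = ν.map fun x => 1 * x + (m : ℂ) := by
  simp only [shiftLaw, one_mul]

theorem gaussian_not_approx_le {c n : ℕ} (hn : 1 ≤ logLog n) {ε κ : ℝ} (hε : 1 / logLog n ≤ ε)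
    (hκ : 1 / (n : ℝ) ^ c ≤ κ) :
    matrixLaw (fun _ _ : Fin n => complexGaussian ε)
      {A | ¬ ApproxPermanent permanentProgram κ n (ε : ℂ) A} ≤ failureBound c n := by
  have hn0 : 0 < logLog n := by linarith
  have hε0 : 0 < ε := (one_div_pos.2 hn0).trans_le hε
  have h := gaussian_not_isGood_le (c := c) hn (inv_pos.2 hε0)
    (by rwa [inv_le_comm₀ hε0 hn0, ← one_div])
  rw [complexGaussian_eq_shiftLaw, shiftLaw_eq]
  refine (measure_not_approx_le hn0 hκ (fun _ _ => complexGaussian_hasMeanVariance.1) 1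
    (by exact_mod_cast hε0.ne')).trans ?_
  rw [one_mul, ← Complex.ofReal_inv]
  exact h

/-! ### General entries -/

/-- The chosen candidate `z = (1 - x)/ε` gives the mean `ε/(1 - x)`. As `0 ≤ x ≤ 1/2` and `x ≤
1/logLog n ≤ ε`, it is at most `ε (1 + 2x) ≤ ε + 2 ε²`. -/
theorem exists_mean {c n : ℕ} (hn : 2 ≤ logLog n) {ε : ℝ} (hε : 1 / logLog n ≤ ε)
    {ν : Fin n → Fin n → Measure ℂ} (h : ∀ i j, HasMeanVariance (ν i j) 0 1) :
    ∃ μ ∈ Set.Icc ε (ε + 2 * ε ^ 2), ∀ κ : ℝ, 1 / (n : ℝ) ^ c ≤ κ →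
      matrixLaw (fun i j => shiftLaw (ν i j) μ)
        {A | ¬ ApproxPermanent permanentProgram κ n (μ : ℂ) A} ≤ failureBound c n := by
  have hn0 : 0 < logLog n := by linarith
  have hε0 : 0 < ε := (one_div_pos.2 hn0).trans_le hε
  have hℓ : 0 < 1 / logLog n := one_div_pos.2 hn0
  have hℓ2 : 1 / logLog n ≤ 1 / 2 := one_div_le_one_div_of_le (by norm_num) hn
  have hsep := separated_interval (inv_pos.2 hε0) hℓ (hℓ2.trans (by norm_num)) (numPoints n)
  obtain ⟨j, hj, hle⟩ := exists_candidate h hn0 (inv_pos.2 hε0) hsep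
  have hN : (0 : ℝ) < numPoints n := by exact_mod_cast (Nat.zero_le j).trans_lt hj
  have hjN : (j : ℝ) / numPoints n ≤ 1 := (div_le_one hN).2 (by exact_mod_cast hj.le)
  have hj0 : 0 ≤ (j : ℝ) / numPoints n := by positivity
  obtain ⟨x, hx⟩ : ∃ x, x = 1 / logLog n * (j / numPoints n) := ⟨_, rfl⟩
  have hx0 : 0 ≤ x := hx ▸ by positivity
  have hx1 : x ≤ 1 / logLog n := by rw [hx]; nlinarith
  rw [← hx] at hle
  have h1x : 0 < 1 - x := by linarith
  have hz : ((ε⁻¹ * (1 - x) : ℝ) : ℂ) = 1 * ((ε / (1 - x) : ℝ) : ℂ)⁻¹ := by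
    rw [one_mul, ← Complex.ofReal_inv, inv_div, div_eq_inv_mul]
  refine ⟨ε / (1 - x), ⟨?_, ?_⟩, fun κ hκ => ?_⟩
  · rw [le_div_iff₀ h1x]
    nlinarith
  · rw [div_le_iff₀ h1x]
    nlinarith [mul_nonneg hε0.le (mul_nonneg hx0 h1x.le), mul_nonneg hε0.le hx0,
      mul_nonneg (mul_nonneg hε0.le (sub_nonneg.2 (hx1.trans hε))) h1x.le,
      mul_nonneg (mul_nonneg hε0.le hx0) (show 0 ≤ 1 / 2 - x by linarith)]
  · simp only [shiftLaw_eq]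
    refine (measure_not_approx_le hn0 hκ (fun i j => (h i j).1) 1
      (by exact_mod_cast (div_pos hε0 h1x).ne')).trans ?_
    rw [← hz]
    refine measure_not_isGood_le h hn0 ((hsep.norm_le j hj).trans' (le_of_eq (by rw [hx])) |>.trans ?_) hle
    rwa [inv_le_comm₀ hε0 hn0, ← one_div]

/-! ### Biased Bernoulli entries -/

/-- The law of a random sign. -/
noncomputable def randomSign : Measure ℂ :=
  (1 / 2 : ENNReal) • Measure.dirac (1 : ℂ) + (1 / 2 : ENNReal) • Measure.dirac (-1 : ℂ)

theorem randomSign_hasMeanVariance : HasMeanVariance randomSign 0 1 := by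
  have hint : ∀ f : ℂ → ℂ, Integrable f randomSign := fun f => by
    refine Integrable.add_measure ?_ ?_ <;>
    exact (integrable_dirac (by simp)).smul_measure (by simp)
  have hint' : ∀ f : ℂ → ℝ, Integrable f randomSign := fun f => by
    refine Integrable.add_measure ?_ ?_ <;>
    exact (integrable_dirac (by simp)).smul_measure (by simp)
  have hhalf : (1 / 2 : ENNReal).toReal = 1 / 2 := by simp
  refine ⟨⟨?_⟩, ?_, ?_, ?_⟩
  · simp [randomSign, ENNReal.inv_two_add_inv_two]
  · rw [memLp_two_iff_integrable_sq_norm (by fun_prop)]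
    exact hint' _
  · have h := hint fun x => x
    unfold randomSign at h ⊢
    rw [integral_add_measure h.left_of_add_measure h.right_of_add_measure,
      integral_smul_measure, integral_smul_measure, integral_dirac, integral_dirac, hhalf]
    simp
  · have h := hint' fun x => ‖x - 0‖ ^ 2
    unfold randomSign at h ⊢
    rw [integral_add_measure h.left_of_add_measure h.right_of_add_measure,
      integral_smul_measure, integral_smul_measure, integral_dirac, integral_dirac, hhalf]
    simp
    norm_num

theorem biasedBernoulli_eq (μ : ℝ) :
    biasedBernoulli μ = randomSign.map fun x => ((1 - μ / 2 : ℝ) : ℂ) * x + ((μ / 2 : ℝ) : ℂ) := by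
  have hf : Measurable fun x : ℂ => ((1 - μ / 2 : ℝ) : ℂ) * x + ((μ / 2 : ℝ) : ℂ) := by fun_prop
  have e₁ : ((1 - μ / 2 : ℝ) : ℂ) * 1 + ((μ / 2 : ℝ) : ℂ) = 1 := by
    push_cast
    ring
  have e₂ : ((1 - μ / 2 : ℝ) : ℂ) * (-1) + ((μ / 2 : ℝ) : ℂ) = -1 + (μ : ℂ) := by
    push_cast
    ring
  rw [randomSign, Measure.map_add _ _ hf, Measure.map_smul, Measure.map_smul,
    Measure.map_dirac' hf, Measure.map_dirac' hf, biasedBernoulli, e₁, e₂]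

theorem exists_bernoulli_mean {c n : ℕ} (hn : 4 ≤ logLog n) :
    ∃ μ ∈ Set.Icc (logLog n ^ (-1 : ℝ)) (logLog n ^ (-(1 / 2) : ℝ)), ∀ κ : ℝ,
      1 / (n : ℝ) ^ c ≤ κ →
      matrixLaw (fun _ _ : Fin n => biasedBernoulli μ)
        {A | ¬ ApproxPermanent permanentProgram κ n ((μ / 2 : ℝ) : ℂ) A} ≤ failureBound c n := by
  have hn0 : 0 < logLog n := by linarith
  have hℓ : 0 < 1 / logLog n := one_div_pos.2 hn0
  have hℓ1 : 1 / logLog n ≤ 1 := (div_le_one hn0).2 (by linarith)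
  have hsep := separated_interval hn0 hℓ hℓ1 (numPoints n)
  have hR := randomSign_hasMeanVariance
  obtain ⟨j, hj, hle⟩ := exists_candidate (fun _ _ : Fin n => hR) hn0 hn0 hsep
  have hN : (0 : ℝ) < numPoints n := by exact_mod_cast (Nat.zero_le j).trans_lt hj
  have hjN : (j : ℝ) / numPoints n ≤ 1 := (div_le_one hN).2 (by exact_mod_cast hj.le)
  have hj0 : 0 ≤ (j : ℝ) / numPoints n := by positivity
  obtain ⟨x, hx⟩ : ∃ x, x = logLog n * (1 - 1 / logLog n * (j / numPoints n)) := ⟨_, rfl⟩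
  have hx' : x = logLog n - j / numPoints n := by rw [hx]; field_simp
  rw [← hx] at hle
  have hx1 : 0 < x + 1 := by linarith
  have hz : ((1 - 2 / (x + 1) / 2 : ℝ) : ℂ) * ((2 / (x + 1) / 2 : ℝ) : ℂ)⁻¹ = (x : ℂ) := by
    rw [← Complex.ofReal_inv, ← Complex.ofReal_mul]
    congr 1
    field_simp
    ring
  -- An entry is `(1 - μ/2)` times a random sign plus `μ/2`, so the relevant point is `(1 -
  -- μ/2)/(μ/2) = 2/μ - 1`; this solves for `x`. As `x + 1 ≥ logLog n`, the upper bound for `μ`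
  -- needs `√(logLog n) ≥ 2`, hence the assumption `4 ≤ logLog n`.
  refine ⟨2 / (x + 1), ⟨?_, ?_⟩, fun κ hκ => ?_⟩
  · rw [Real.rpow_neg_one, inv_le_comm₀ hn0 (by positivity), inv_div]
    linarith
  · rw [Real.rpow_neg hn0.le, ← Real.sqrt_eq_rpow, le_inv_comm₀ (by positivity) (by positivity),
      inv_div, le_div_iff₀ (by norm_num)]
    have h2 : √(logLog n) * √(logLog n) = logLog n := Real.mul_self_sqrt hn0.le
    have h3 : 2 ≤ √(logLog n) := Real.le_sqrt_of_sq_le (by linarith)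
    nlinarith
  · simp only [biasedBernoulli_eq]
    refine (measure_not_approx_le hn0 hκ (fun _ _ => hR.1) _
      (by exact_mod_cast (by positivity : (0:ℝ) < 2 / (x + 1) / 2).ne')).trans ?_
    rw [hz]
    refine measure_not_isGood_le (fun _ _ => hR) hn0 ?_ hle
    rw [hx]
    exact hsep.norm_le j hj

/-! ### The theorem -/

/-- The argument needs only this weaker bound: eventually the base lies between `1/logLog n` and 1,
and the exponent `1/7` can only increase it. -/
theorem eventually_one_div_logLog_le {ε : ℕ → ℝ} (hε : MeanLowerBound ε) :
    ∀ᶠ n in atTop, 1 / logLog n ≤ ε n := by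
  filter_upwards [hε, tendsto_logLog.eventually_ge_atTop (Real.exp 1)] with n h1 h2
  refine le_trans ?_ h1
  change 1 / logLog n ≤ (Real.log (logLog n) / logLog n) ^ (1 / 7 : ℝ)
  have h0 : 0 < logLog n := (Real.exp_pos 1).trans_le h2
  have hlog : 1 ≤ Real.log (logLog n) := by
    rw [Real.le_log_iff_exp_le h0]; exact h2
  have hlog2 : Real.log (logLog n) ≤ logLog n := (Real.log_le_self h0.le)
  have hle : 1 / logLog n ≤ Real.log (logLog n) / logLog n := by gcongr
  refine hle.trans ?_
  exact Real.self_le_rpow_of_le_one (by positivity) ((div_le_one h0).2 hlog2) (by norm_num)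

theorem typically_of_le {P : Program} {η m : ℕ → ℝ} {law : (n : ℕ) → Measure (Fin n → Fin n → ℂ)}
    {c : ℕ} (h : ∀ᶠ n in atTop, law n {A | ¬ ApproxPermanent P (η n) n (m n : ℂ) A} ≤
      failureBound c n) : ApproxPermanentTypically P η m law :=
  tendsto_of_tendsto_of_tendsto_of_le_of_le' tendsto_const_nhds (tendsto_failureBound c)
    (Eventually.of_forall fun _ => zero_le) h

theorem theorem5p1 (δ : ℕ → ℝ) (hδ : InvPoly δ) :
    ∃ (P : Program) (C : ℝ), 0 < C ∧ QuasiPolyTime P ∧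
      (∀ ε : ℕ → ℝ, MeanLowerBound ε →
        (∀ D : (n : ℕ) → Fin n → Fin n → Measure ℂ,
          (∀ n i j, HasMeanVariance (D n i j) 0 1) →
          ∃ μ : ℕ → ℝ, (∀ n, μ n ∈ Set.Icc (ε n) (ε n + 2 * ε n ^ 2)) ∧
            ApproxPermanentTypically P (fun n => C * δ n) μ
              (fun n => matrixLaw fun i j => shiftLaw (D n i j) (μ n))) ∧
        ApproxPermanentTypically P (fun n => C * δ n) ε
          (fun n => matrixLaw fun _ _ => complexGaussian (ε n))) ∧
      (∃ μ : ℕ → ℝ, InvPolyLogLog μ ∧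
        ApproxPermanentTypically P (fun n => C * δ n) μ
          (fun n => matrixLaw fun _ _ => complexGaussian (μ n))) ∧
      (∃ μ : ℕ → ℝ, InvPolyLogLog μ ∧
        ApproxPermanentTypically P (fun n => C * δ n) (fun n => μ n / 2)
          (fun n => matrixLaw fun _ _ => biasedBernoulli (μ n))) := by
  obtain ⟨c, hc⟩ := hδ
  have hlarge := tendsto_logLog.eventually_ge_atTop 4
  have hδ1 : ∀ᶠ n : ℕ in atTop, 1 / (n : ℝ) ^ c ≤ 1 * δ n := by simpa only [one_mul] using hc
  -- The program does not depend on `δ`, and `C = 1` suffices; `c` enters only the failure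
  -- probability. For the biased Gaussian, `1 / logLog n` serves as mean.
  refine ⟨permanentProgram, 1, one_pos, permanentProgram_quasiPolyTime, fun ε hε => ⟨fun D hD => ?_,
    ?_⟩, ⟨fun n => 1 / logLog n, ⟨1, 1, one_pos, one_pos, ?_⟩, ?_⟩, ?_⟩
  · have hex : ∀ n, ∃ μ ∈ Set.Icc (ε n) (ε n + 2 * ε n ^ 2),
        2 ≤ logLog n → 1 / logLog n ≤ ε n → ∀ κ : ℝ, 1 / (n : ℝ) ^ c ≤ κ →
        matrixLaw (fun i j => shiftLaw (D n i j) μ)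
          {A | ¬ ApproxPermanent permanentProgram κ n (μ : ℂ) A} ≤ failureBound c n := by
      intro n
      by_cases h : 2 ≤ logLog n ∧ 1 / logLog n ≤ ε n
      · obtain ⟨μ, h1, h2⟩ := exists_mean (c := c) h.1 h.2 (hD n)
        exact ⟨μ, h1, fun _ _ => h2⟩
      -- For the remaining `n` any element of the interval will do, because only the limit matters.
      · exact ⟨ε n, ⟨le_rfl, by nlinarith [sq_nonneg (ε n)]⟩, fun h1 h2 => absurd ⟨h1, h2⟩ h⟩
    choose μ hμ1 hμ2 using hex
    refine ⟨μ, hμ1, typically_of_le (c := c) ?_⟩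
    filter_upwards [hlarge, eventually_one_div_logLog_le hε, hδ1] with n h1 h2 h3
    exact hμ2 n (by linarith) h2 _ h3
  · refine typically_of_le (c := c) ?_
    filter_upwards [hlarge, eventually_one_div_logLog_le hε, hδ1] with n h1 h2 h3
    exact gaussian_not_approx_le (by linarith) h2 h3
  · filter_upwards with n
    rw [Real.rpow_neg_one, one_div]
    exact ⟨le_rfl, le_rfl⟩
  · refine typically_of_le (c := c) ?_
    filter_upwards [hlarge, hδ1] with n h1 h3
    exact gaussian_not_approx_le (by linarith) le_rfl h3
  · have hex : ∀ n, ∃ μ : ℝ, 4 ≤ logLog n →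
        μ ∈ Set.Icc (logLog n ^ (-1 : ℝ)) (logLog n ^ (-(1 / 2) : ℝ)) ∧ ∀ κ : ℝ,
        1 / (n : ℝ) ^ c ≤ κ →
        matrixLaw (fun _ _ : Fin n => biasedBernoulli μ)
          {A | ¬ ApproxPermanent permanentProgram κ n ((μ / 2 : ℝ) : ℂ) A} ≤ failureBound c n := by
      intro n
      by_cases h : 4 ≤ logLog n
      · obtain ⟨μ, h1, h2⟩ := exists_bernoulli_mean (c := c) h
        exact ⟨μ, fun _ => ⟨h1, h2⟩⟩
      · exact ⟨0, fun h1 => absurd h1 h⟩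
    choose μ hμ using hex
    refine ⟨μ, ⟨1, 1 / 2, one_pos, by norm_num, ?_⟩, typically_of_le (c := c) ?_⟩
    · filter_upwards [hlarge] with n h1
      exact (hμ n h1).1
    · filter_upwards [hlarge, hδ1] with n h1 h3
      exact (hμ n h1).2 _ h3
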